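/- Let $k\ge 1$, let $\mathcal P$ be a set of $k+1$ pages, and let $G=\langle v_1,\dots,v_m\rangle$ be a finite simple path whose vertices are labeled with pages by a surjective map $\ell:\{v_1,\dots,v_m\}\to\mathcal P$ (a page may label several vertices). A request sequence of $G$ is $\sigma=(\ell(u_1),\dots,\ell(u_n))$, where $u_{t+1}=u_t$ or $u_tu_{t+1}$ is an edge of $G$ for every $t$. A paging algorithm has a memory of $k$ page slots, initially empty; a page enters the memory only when it is requested, and must be in memory right after its request; a request for a page that is not in memory is a fault. $\mathrm{OPT}(k,\sigma)$ is the least number of faults with which $\sigma$ can be served offline. Deterministic online algorithms know $G$, $k$ and the vertices $u_1,\dots,u_t$ requested so far; a randomized online algorithm is a probability distribution on deterministic ones. The strict competitive ratio $r_A(G,k)$ is the infimum of all $r$ with $E[A(k,\sigma)]\le r\,\mathrm{OPT}(k,\sigma)$ for all request sequences $\sigma$ of $G$, where $A(k,\sigma)$ is the number of faults of $A$; the asymptotic ratio $r_A^\infty(G,k)$ is the infimum of all $r$ for which there is $C\ge 0$ with $E[A(k,\sigma)]\le r\,\mathrm{OPT}(k,\sigma)+C$ for all $\sigma$; and $r^\infty_{\mathsf{obl}}(G,k)=\inf_A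 r_A^\infty(G,k)$ over the randomized online algorithms $A$. The requests are divided into phases: the first phase begins with the first request, and a new phase begins with each request for what would be the $(k+1)$-st distinct page of the current phase. A page is marked if it has been requested in the current phase (the current request included). For a vertex $v_i$ write $p\prec_i q$ if every path from $v_i$ to a vertex labeled $q$ includes a vertex labeled $p$; this is a partial order on $\mathcal P$, and $M_i$ denotes its set of maximal elements. MAXFAR is the following deterministic online algorithm. It evicts nothing at a hit or while a slot is free. At a fault with full memory in a phase that began at $v_i$, let $N$ be the set of unmarked pages of $M_i$ and $N'$ the set of those pages of $N$ that appear on both sides of $v_i$ in $G$. If $N'\neq\emptyset$, it evicts a middle element of $N'$ in the order in which these pages are first met going left from $v_i$ (a page with at most $|N'|/2$ elements of $N'$ before it and at most $|N'|/2$ after it); if $N'=\emptyset$, it evicts some page of $N$. Ties are broken arbitrarily. Then there is an absolute constant $c$ such that for all $k$, $\mathcal P$, $G$ and $\ell$ as above the following hold. 1. MAXFAR is well defined (a page to evict as prescribed exists in memory whenever one is needed), and, however ties are broken, $r_{\mathrm{MAXFAR}}(G,k)\le c\, r^\infty_{\mathsf{obl}}(G,k)$. The same holds if $r^\infty_{\mathsf{obl}}(G,k)$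 is taken only over the randomized online algorithms that see the names of the requested pages but not the vertices. 2. $\max_i\log|M_i|\le c\, r^\infty_{\mathsf{obl}}(G,k)$. 3. MAXFAR faults at most $c\,(1+\max_i\log|M_i|)$ times in every phase other than the first. -/

import Mathlib

open scoped ENNReal NNReal

noncomputable section

/-! ### Serving a sequence of page requests with `k` slots -/

/-- `C i` is the set of pages in memory after the first `i` requests of `ρ`. The memory has `k`
slots and is empty at the start; a page enters the memory only at a request for it, the requested
page is in memory after its request, and other pages may be evicted. -/
structure IsService {P : Type*} [DecidableEq P] (k : ℕ) (ρ : List P) (C : ℕ → Finset P) :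
    Prop where
  start : C 0 = ∅
  serves : ∀ i : Fin ρ.length, ρ.get i ∈ C (i + 1)
  demand : ∀ i : Fin ρ.length, C (i + 1) ⊆ insert (ρ.get i) (C i)
  slots : ∀ i : Fin ρ.length, (C (i + 1)).card ≤ k

/-- The number of page faults: requests for a page that is not in memory. -/
def faultCount {P : Type*} [DecidableEq P] (ρ : List P) (C : ℕ → Finset P) : ℕ :=
  (Finset.univ.filter fun i : Fin ρ.length => ρ.get i ∉ C i).card

/-- The optimal offline cost of a sequence of page requests (used with `k ≥ 1` only). -/
def optCost {P : Type*} [DecidableEq P] (k : ℕ) (ρ : List P) : ℕ :=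
  sInf {n | ∃ C : ℕ → Finset P, IsService k ρ C ∧ faultCount ρ C = n}

/-! ### Extended access graphs and online algorithms -/

/-- An undirected graph whose vertices are labeled with pages. -/
structure ExtendedAccessGraph (V P : Type*) where
  graph : SimpleGraph V
  label : V → P

namespace ExtendedAccessGraph

/-- The finite vertex sequences that generate the request sequences of `G`: consecutive vertices
are equal or adjacent. -/
def IsWalk {V P : Type*} (G : ExtendedAccessGraph V P) (σ : List V) : Prop :=
  σ.IsChain fun u v => u = v ∨ G.graph.Adj u v

end ExtendedAccessGraph

/-- A deterministic online paging algorithm for `G` with `k` slots: `serve σ` is the set of pages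
in memory after the requests `σ`, chosen with knowledge of `G`, `k` and the requests so far. The
algorithm is shown the requested vertices, not only their labels. -/
structure OnlineAlg {V P : Type*} [DecidableEq P] (G : ExtendedAccessGraph V P) (k : ℕ) where
  serve : List V → Finset P
  valid : ∀ σ : List V, IsService k (σ.map G.label) (fun i => serve (σ.take i))

namespace OnlineAlg

variable {V P : Type*} [DecidableEq P] {G : ExtendedAccessGraph V P} {k : ℕ}

/-- The number of faults of `A` on the requests generated by `σ`. -/
def faults (A : OnlineAlg G k) (σ : List V) : ℕ :=
  faultCount (σ.map G.label) (fun i => A.serve (σ.take i))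

/-- The decisions of the algorithm depend only on the names of the requested pages. -/
def PagesOnly (A : OnlineAlg G k) : Prop :=
  ∀ σ τ : List V, σ.map G.label = τ.map G.label → A.serve σ = A.serve τ

/-- The strict competitive ratio of a deterministic algorithm. -/
def strictRatio (A : OnlineAlg G k) : ℝ≥0∞ :=
  sInf {r : ℝ≥0∞ | ∀ σ : List V, G.IsWalk σ →
    (A.faults σ : ℝ≥0∞) ≤ r * (optCost k (σ.map G.label) : ℝ≥0∞)}

/-- The σ-algebra generated by all the decisions `A ↦ A.serve σ`. -/
instance : MeasurableSpace (OnlineAlg G k) :=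
  ⨆ σ : List V, MeasurableSpace.comap (fun A : OnlineAlg G k => A.serve σ) ⊤

end OnlineAlg

/-- A randomized online algorithm is a probability distribution on deterministic ones; against an
oblivious adversary its cost on `σ` is the expected number of faults. -/
def expectedFaults {V P : Type*} [DecidableEq P] {G : ExtendedAccessGraph V P} {k : ℕ}
    (μ : MeasureTheory.ProbabilityMeasure (OnlineAlg G k)) (σ : List V) : ℝ≥0∞ :=
  ∫⁻ A, (A.faults σ : ℝ≥0∞) ∂(μ : MeasureTheory.Measure (OnlineAlg G k))

/-- The asymptotic competitive ratio of a randomized algorithm. -/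
def asymptoticRatio {V P : Type*} [DecidableEq P] {G : ExtendedAccessGraph V P} {k : ℕ}
    (μ : MeasureTheory.ProbabilityMeasure (OnlineAlg G k)) : ℝ≥0∞ :=
  sInf {r : ℝ≥0∞ | ∃ C : ℝ≥0, ∀ σ : List V, G.IsWalk σ →
    expectedFaults μ σ ≤ r * (optCost k (σ.map G.label) : ℝ≥0∞) + (C : ℝ≥0∞)}

namespace ExtendedAccessGraph

variable {V P : Type*} [DecidableEq P]

/-- The randomized asymptotic competitive ratio of the paging problem `(G, k)`, over the
algorithms that are shown the requested vertices. -/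
def rOblAsymp (G : ExtendedAccessGraph V P) (k : ℕ) : ℝ≥0∞ :=
  ⨅ μ : MeasureTheory.ProbabilityMeasure (OnlineAlg G k), asymptoticRatio μ

/-- The same ratio over the algorithms that are shown only the names of the requested pages. -/
def rOblAsympPages (G : ExtendedAccessGraph V P) (k : ℕ) : ℝ≥0∞ :=
  ⨅ μ : {μ : MeasureTheory.ProbabilityMeasure (OnlineAlg G k) //
    ∀ᵐ A ∂(μ : MeasureTheory.Measure (OnlineAlg G k)), A.PagesOnly}, asymptoticRatio μ.1

/-- The current phase after the requests `σ`: a request that would be for the `(k+1)`-st distinct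
page of the phase begins a new phase. -/
def currentPhase (G : ExtendedAccessGraph V P) (k : ℕ) (σ : List V) : List V :=
  σ.foldl (fun ph v =>
    if ((ph ++ [v]).map G.label).toFinset.card ≤ k then ph ++ [v] else [v]) []

/-- The pages requested in the current phase. -/
def marked (G : ExtendedAccessGraph V P) (k : ℕ) (σ : List V) : Finset P :=
  ((G.currentPhase k σ).map G.label).toFinset

/-- `p ≺_v q`: every path from `v` to a vertex labeled `q` includes a vertex labeled `p`. -/
def Precedes (G : ExtendedAccessGraph V P) (v : V) (p q : P) : Prop :=
  ∀ (u : V) (w : G.graph.Walk v u), G.label u = q → ∃ x ∈ w.support, G.label x = p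

open scoped Classical in
/-- The set of `≺_v`-maximal pages. -/
def maximalPages [Fintype P] (G : ExtendedAccessGraph V P) (v : V) : Finset P :=
  Finset.univ.filter fun p => ∀ q, G.Precedes v p q → q = p

end ExtendedAccessGraph

/-! ### Simple paths and the algorithm MAXFAR -/

/-- The path `0, 1, …, m - 1` (from left to right) labeled by `ℓ`. -/
def pathEAG {m : ℕ} {P : Type*} (ℓ : Fin m → P) : ExtendedAccessGraph (Fin m) P where
  graph := SimpleGraph.pathGraph m
  label := ℓ

/-- The page `p` appears on both sides of the vertex `i`. -/
def OnBothSides {m : ℕ} {P : Type*} (ℓ : Fin m → P) (i : Fin m) (p : P) : Prop :=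
  (∃ a, a < i ∧ ℓ a = p) ∧ (∃ b, i < b ∧ ℓ b = p)

/-- Going left from `i`, a vertex labeled `p` is reached before any vertex labeled `q`. -/
def LeftBefore {m : ℕ} {P : Type*} (ℓ : Fin m → P) (i : Fin m) (p q : P) : Prop :=
  ∃ a, a < i ∧ ℓ a = p ∧ ∀ b, a ≤ b → b < i → ℓ b ≠ q

open scoped Classical in
/-- `q` is a middle element of the set `N` in the order of first appearance to the left of `i`. -/
def IsMiddle {m : ℕ} {P : Type*} (ℓ : Fin m → P) (i : Fin m) (N : Finset P) (q : P) : Prop :=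
  q ∈ N ∧ 2 * (N.filter fun p => LeftBefore ℓ i p q).card ≤ N.card ∧
    2 * (N.filter fun p => LeftBefore ℓ i q p).card ≤ N.card

section

variable {m : ℕ} {P : Type*} [Fintype P] [DecidableEq P]

/-- The set of unmarked `≺_i`-maximal pages after the requests `σ`. -/
def unmarkedMaximal (ℓ : Fin m → P) (k : ℕ) (σ : List (Fin m)) (i : Fin m) : Finset P :=
  (pathEAG ℓ).maximalPages i \ (pathEAG ℓ).marked k σ

open scoped Classical in
/-- MAXFAR may evict `q` at a fault on the last request of `σ`: with `i` the vertex at which the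
current phase began, `q` is a middle element among those unmarked `≺_i`-maximal pages that appear
on both sides of `i`, or any unmarked `≺_i`-maximal page if none of them appears on both sides. -/
def MaxfarVictim (ℓ : Fin m → P) (k : ℕ) (σ : List (Fin m)) (q : P) : Prop :=
  ∃ i, ((pathEAG ℓ).currentPhase k σ).head? = some i ∧
    if ((unmarkedMaximal ℓ k σ i).filter fun p => OnBothSides ℓ i p).Nonempty then
      IsMiddle ℓ i ((unmarkedMaximal ℓ k σ i).filter fun p => OnBothSides ℓ i p) q
    else q ∈ unmarkedMaximal ℓ k σ i

/-- `A` is the algorithm MAXFAR, with some way to break ties: nothing is evicted at a hit or while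
a slot is free, and at a fault with full memory one page is evicted, by the rule of MAXFAR. -/
def IsMaxfar (ℓ : Fin m → P) (k : ℕ) (A : OnlineAlg (pathEAG ℓ) k) : Prop :=
  ∀ (σ : List (Fin m)) (v : Fin m), (pathEAG ℓ).IsWalk (σ ++ [v]) →
    (ℓ v ∈ A.serve σ → A.serve (σ ++ [v]) = A.serve σ) ∧
    (ℓ v ∉ A.serve σ → (A.serve σ).card < k →
      A.serve (σ ++ [v]) = insert (ℓ v) (A.serve σ)) ∧
    (ℓ v ∉ A.serve σ → (A.serve σ).card = k →
      ∃ q ∈ A.serve σ, MaxfarVictim ℓ k (σ ++ [v]) q ∧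
        A.serve (σ ++ [v]) = insert (ℓ v) ((A.serve σ).erase q))

/-- `max_i log |M_i|`, with `M_i` the set of `≺_i`-maximal pages. -/
def maxLogMaximal (ℓ : Fin m → P) : ℝ :=
  ⨆ i : Fin m, Real.log ((pathEAG ℓ).maximalPages i).card

end

end

/-! ### Services, request by request -/

section Services

variable {P : Type*} [DecidableEq P] {k : ℕ}

/-! Two geometric facts about a path drive both bounds. The vertices visited in a phase that began
at `i` form a segment around `i`, and `M_i` is linearly ordered by first appearance to the left of
`i`, the order on the right being the reverse (`leftBefore_total`, `LeftBefore.exists_right`).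

Upper bound. After the first phase exactly one page is missing from memory: the last victim `q`,
unmarked and maximal. The next fault in the phase is a request for `q`. If it was reached on the
left, all pages before `q` in the left order are now marked; if on the right, all pages after it. As
`q` was a middle element, the number of unmarked two-sided maximal pages halves; at most two maximal
pages are one-sided. So a later phase has O(1 + log |M_i|) faults (`VictimRule.potential_lt`,
`IsMaxfar.state`). Every service pays at least one fault per phase change and one per distinct page,
the latter covering the first phase of MAXFAR; hence a strict bound (`IsMaxfar.faults_le_optCost`).

Lower bound. Take 2^d pages of `M_i` and split them in half by the left order. Every page is
reachable from `i` while avoiding one of the halves (`exists_clearOf_or`), so of two closed walks,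
each requesting everything reachable while avoiding its half, at least one requests the page missing
from memory. A random half thus costs half a fault on average. Recursing into the avoided half gives
a round of expected cost d/2 that avoids some page altogether (`exists_round`), and such a round
costs the optimum at most 1, up to `k` in total (`optCost_flatten_le`). Averaging transfers this to
randomized algorithms. Together with the trivial bound that the ratio is at least 1, this dominates
the upper bound. -/

theorem faultCount_eq_card_range (ρ : List P) (C : ℕ → Finset P) :
    faultCount ρ C = ((Finset.range ρ.length).filter fun i => ∀ p ∈ ρ[i]?, p ∉ C i).card := by
  unfold faultCount
  refine Finset.card_bij (fun i _ => (i : ℕ)) ?_ ?_ ?_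
  · intro i hi
    simp only [Finset.mem_filter, Finset.mem_univ, true_and] at hi
    simpa using hi
  · intro i _ j _ h
    exact Fin.ext h
  · intro j hj
    simp only [Finset.mem_filter, Finset.mem_range] at hj
    refine ⟨⟨j, hj.1⟩, ?_, rfl⟩
    simpa [hj.1] using hj.2

@[simp] theorem faultCount_nil (C : ℕ → Finset P) : faultCount ([] : List P) C = 0 := by
  simp [faultCount_eq_card_range]

theorem faultCount_congr {ρ : List P} {C D : ℕ → Finset P} (h : ∀ i < ρ.length, C i = D i) :
    faultCount ρ C = faultCount ρ D := by
  unfold faultCount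
  congr 1
  ext i
  simp [h i i.2]

theorem faultCount_append_singleton (ρ : List P) (p : P) (C : ℕ → Finset P) :
    faultCount (ρ ++ [p]) C = faultCount ρ C + if p ∈ C ρ.length then 0 else 1 := by
  have h : (Finset.range ρ.length).filter (fun i => ∀ q ∈ (ρ ++ [p])[i]?, q ∉ C i) =
      (Finset.range ρ.length).filter fun i => ∀ q ∈ ρ[i]?, q ∉ C i := by
    refine Finset.filter_congr fun i hi => ?_
    rw [List.getElem?_append_left (Finset.mem_range.1 hi)]
  rw [faultCount_eq_card_range, faultCount_eq_card_range, List.length_append,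
    List.length_singleton, Finset.range_add_one, Finset.filter_insert, h]
  by_cases hp : p ∈ C ρ.length <;> simp [hp]

theorem isService_append_singleton {ρ : List P} {p : P} {C : ℕ → Finset P} :
    IsService k (ρ ++ [p]) C ↔ IsService k ρ C ∧ p ∈ C (ρ.length + 1) ∧
      C (ρ.length + 1) ⊆ insert p (C ρ.length) ∧ (C (ρ.length + 1)).card ≤ k := by
  constructor
  · rintro ⟨h0, h1, h2, h3⟩
    have hi : ∀ i : Fin ρ.length, (i : ℕ) < (ρ ++ [p]).length := fun i => by
      rw [List.length_append]; omega
    refine ⟨⟨h0, fun i => ?_, fun i => ?_, fun i => ?_⟩, ?_, ?_, ?_⟩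
    · simpa [List.getElem_append_left] using h1 ⟨i, hi i⟩
    · simpa [List.getElem_append_left] using h2 ⟨i, hi i⟩
    · exact h3 ⟨i, hi i⟩
    · simpa using h1 ⟨ρ.length, by simp⟩
    · simpa using h2 ⟨ρ.length, by simp⟩
    · exact h3 ⟨ρ.length, by simp⟩
  · rintro ⟨⟨h0, h1, h2, h3⟩, h4, h5, h6⟩
    have key : ∀ i : Fin (ρ ++ [p]).length, (i : ℕ) < ρ.length ∨ (i : ℕ) = ρ.length := by
      intro i
      have := i.2
      simp at this
      omega
    refine ⟨h0, fun i => ?_, fun i => ?_, fun i => ?_⟩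
    · rcases key i with h | h
      · simpa [List.getElem_append_left h] using h1 ⟨i, h⟩
      · simpa [h] using h4
    · rcases key i with h | h
      · simpa [List.getElem_append_left h] using h2 ⟨i, h⟩
      · simpa [h] using h5
    · rcases key i with h | h
      · exact h3 ⟨i, h⟩
      · simpa [h] using h6

theorem isService_nil {C : ℕ → Finset P} : IsService k ([] : List P) C ↔ C 0 = ∅ :=
  ⟨fun h => h.start, fun h => ⟨h, fun i => i.elim0, fun i => i.elim0, fun i => i.elim0⟩⟩

theorem IsService.congr {ρ : List P} {C D : ℕ → Finset P} (hC : IsService k ρ C)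
    (h : ∀ i ≤ ρ.length, C i = D i) : IsService k ρ D := by
  refine ⟨?_, fun i => ?_, fun i => ?_, fun i => ?_⟩
  · rw [← h 0 (Nat.zero_le _), hC.start]
  · rw [← h _ i.2]; exact hC.serves i
  · rw [← h _ i.2, ← h _ i.2.le]; exact hC.demand i
  · rw [← h _ i.2]; exact hC.slots i

theorem IsService.of_append {ρ τ : List P} {C : ℕ → Finset P} (h : IsService k (ρ ++ τ) C) :
    IsService k ρ C := by
  induction τ using List.reverseRecOn with
  | nil => simpa using h
  | append_singleton τ p ih =>
    rw [← List.append_assoc] at h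
    exact ih (isService_append_singleton.1 h).1

theorem IsService.card_le {ρ : List P} {C : ℕ → Finset P} (h : IsService k ρ C) :
    (C ρ.length).card ≤ k := by
  cases ρ using List.reverseRecOn with
  | nil => simp [h.start]
  | append_singleton ρ p =>
    simpa using (isService_append_singleton.1 h).2.2.2

/-- Requests for a page that is missing at the start of `τ` cost at least one fault. -/
theorem IsService.faultCount_lt_of_mem {ρ τ : List P} {C : ℕ → Finset P} {x : P}
    (h : IsService k (ρ ++ τ) C) (hx : x ∉ C ρ.length) (hτ : x ∈ τ) :
    faultCount ρ C < faultCount (ρ ++ τ) C := by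
  -- Until the first fault in `τ` the memory can only shrink, so every page requested was present at
  -- the start of `τ`.
  have key : faultCount ρ C < faultCount (ρ ++ τ) C ∨
      (faultCount ρ C = faultCount (ρ ++ τ) C ∧ C (ρ ++ τ).length ⊆ C ρ.length ∧
        ∀ y ∈ τ, y ∈ C ρ.length) := by
    clear hτ
    induction τ using List.reverseRecOn with
    | nil => simp
    | append_singleton τ p ih =>
      rw [← List.append_assoc] at h ⊢
      obtain ⟨h1, -, h3, -⟩ := isService_append_singleton.1 h
      rw [faultCount_append_singleton]
      rcases ih h1 with h4 | ⟨h4, h5, h6⟩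
      · left; omega
      · by_cases hp : p ∈ C (ρ ++ τ).length
        · right
          rw [if_pos hp]
          rw [Finset.insert_eq_self.2 hp] at h3
          refine ⟨by omega, ?_, ?_⟩
          · rw [List.length_append, List.length_singleton]
            exact h3.trans h5
          · intro y hy
            rcases List.mem_append.1 hy with hy | hy
            · exact h6 y hy
            · rw [List.mem_singleton.1 hy]; exact h5 hp
        · left
          rw [if_neg hp]; omega
  rcases key with h1 | ⟨-, -, h3⟩
  · exact h1
  · exact absurd (h3 x hτ) hx

theorem faultCount_le_append {ρ τ : List P} (C : ℕ → Finset P) :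
    faultCount ρ C ≤ faultCount (ρ ++ τ) C := by
  induction τ using List.reverseRecOn with
  | nil => simp
  | append_singleton τ p ih =>
    rw [← List.append_assoc, faultCount_append_singleton]
    omega

/-- The memory starts empty and holds only pages requested before, so the first request for each
page is a fault. -/
theorem IsService.card_toFinset_le {ρ : List P} {C : ℕ → Finset P} (h : IsService k ρ C) :
    ρ.toFinset.card ≤ faultCount ρ C := by
  suffices H : ρ.toFinset.card ≤ faultCount ρ C ∧ C ρ.length ⊆ ρ.toFinset from H.1
  induction ρ using List.reverseRecOn with
  | nil => simp [h.start]
  | append_singleton ρ p ih =>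
    obtain ⟨h1, -, h3, -⟩ := isService_append_singleton.1 h
    obtain ⟨i1, i2⟩ := ih h1
    have e : (ρ ++ [p]).toFinset = insert p ρ.toFinset := by ext; simp
    rw [e, faultCount_append_singleton]
    refine ⟨?_, ?_⟩
    · by_cases hp : p ∈ C ρ.length
      · rw [Finset.insert_eq_self.2 (i2 hp), if_pos hp]; omega
      · rw [if_neg hp]
        exact (Finset.card_insert_le _ _).trans (by omega)
    · rw [List.length_append, List.length_singleton]
      exact h3.trans (Finset.insert_subset_insert _ i2)

/-- The requests `ρ` can be served with at most `n` faults so that the memory is `S` at the end. -/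
def CanServe (k : ℕ) (ρ : List P) (n : ℕ) (S : Finset P) : Prop :=
  ∃ C : ℕ → Finset P, IsService k ρ C ∧ faultCount ρ C ≤ n ∧ C ρ.length = S

theorem canServe_nil : CanServe k ([] : List P) 0 ∅ :=
  ⟨fun _ => ∅, isService_nil.2 rfl, by simp, rfl⟩

theorem CanServe.append_singleton {ρ : List P} {n : ℕ} {S S' : Finset P} {p : P}
    (h : CanServe k ρ n S) (h1 : p ∈ S') (h2 : S' ⊆ insert p S) (h3 : S'.card ≤ k) :
    CanServe k (ρ ++ [p]) (n + if p ∈ S then 0 else 1) S' := by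
  obtain ⟨C, hC, hn, rfl⟩ := h
  have e : ∀ i ≤ ρ.length, C i = if i ≤ ρ.length then C i else S' := fun i hi => (if_pos hi).symm
  refine ⟨fun i => if i ≤ ρ.length then C i else S', ?_, ?_, by simp⟩
  · refine isService_append_singleton.2 ⟨hC.congr e, ?_, ?_, ?_⟩ <;> simpa
  · rw [faultCount_append_singleton, ← faultCount_congr (fun i hi => e i hi.le)]
    simpa using hn

theorem IsService.optCost_le {ρ : List P} {C : ℕ → Finset P} (h : IsService k ρ C) :
    optCost k ρ ≤ faultCount ρ C :=
  Nat.sInf_le ⟨C, h, rfl⟩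

theorem CanServe.optCost_le {ρ : List P} {n : ℕ} {S : Finset P} (h : CanServe k ρ n S) :
    optCost k ρ ≤ n := by
  obtain ⟨C, hC, hn, -⟩ := h
  exact hC.optCost_le.trans hn

/-- With at least one slot every sequence can be served. -/
theorem exists_isService (hk : 1 ≤ k) (ρ : List P) : ∃ C : ℕ → Finset P, IsService k ρ C := by
  suffices H : ∃ n S, CanServe k ρ n S by
    obtain ⟨n, S, C, hC, -⟩ := H
    exact ⟨C, hC⟩
  induction ρ using List.reverseRecOn with
  | nil => exact ⟨0, ∅, canServe_nil⟩
  | append_singleton ρ p ih =>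
    obtain ⟨n, S, h⟩ := ih
    exact ⟨_, {p}, h.append_singleton (Finset.mem_singleton_self p) (by simp) (by simpa)⟩

theorem exists_isService_eq_optCost (hk : 1 ≤ k) (ρ : List P) :
    ∃ C : ℕ → Finset P, IsService k ρ C ∧ faultCount ρ C = optCost k ρ := by
  obtain ⟨C, hC⟩ := exists_isService hk ρ
  exact Nat.sInf_mem (s := {n | ∃ C : ℕ → Finset P, IsService k ρ C ∧ faultCount ρ C = n})
    ⟨_, C, hC, rfl⟩

/-- Requests that avoid the page `q` can be served so that, up to one fault, every fault
increases the number of pages in memory. -/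
theorem CanServe.append_of_notMem [Fintype P] (hP : Fintype.card P = k + 1) {ρ τ : List P}
    {n : ℕ} {S : Finset P} {q : P} (h : CanServe k ρ n S) (hq : q ∉ τ) :
    ∃ n' S', CanServe k (ρ ++ τ) n' S' ∧ n' + S.card ≤ n + S'.card + 1 := by
  -- The strategy discards `q` and nothing else: the other pages number `k`, so they all fit.
  -- Dropping `q` accounts for the extra 1.
  suffices H : ∃ n' S', CanServe k (ρ ++ τ) n' S' ∧ n' + S.card ≤ n + (S'.erase q).card + 1 by
    obtain ⟨n', S', h1, h2⟩ := H
    exact ⟨n', S', h1, h2.trans (by have := S'.card_erase_le (a := q); omega)⟩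
  induction τ using List.reverseRecOn with
  | nil =>
    refine ⟨n, S, by simpa using h, ?_⟩
    have := Finset.pred_card_le_card_erase (s := S) (a := q)
    omega
  | append_singleton τ p ih =>
    rw [List.mem_append, List.mem_singleton, not_or] at hq
    obtain ⟨n', S', h1, h2⟩ := ih hq.1
    have hsub : insert p (S'.erase q) ⊆ Finset.univ.erase q := by
      intro x hx
      rcases Finset.mem_insert.1 hx with rfl | hx
      · simpa using Ne.symm hq.2
      · simpa using Finset.ne_of_mem_erase hx
    rw [← List.append_assoc]
    refine ⟨_, _, h1.append_singleton (S' := insert p (S'.erase q)) (Finset.mem_insert_self _ _)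
      (Finset.insert_subset_insert _ (Finset.erase_subset _ _)) ?_, ?_⟩
    · refine (Finset.card_le_card hsub).trans ?_
      rw [Finset.card_erase_of_mem (Finset.mem_univ q), Finset.card_univ, hP]
      omega
    · have e : (insert p (S'.erase q)).erase q = insert p (S'.erase q) :=
        Finset.erase_eq_of_notMem fun hx => by simpa using hsub hx
      rw [e]
      by_cases hp : p ∈ S'
      · have : insert p (S'.erase q) = S'.erase q :=
          Finset.insert_eq_self.2 (Finset.mem_erase.2 ⟨Ne.symm hq.2, hp⟩)
        rw [if_pos hp, this]
        omega
      · rw [if_neg hp, Finset.card_insert_of_notMem fun hx => hp (Finset.mem_of_mem_erase hx)]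
        omega

/-- A sequence of `T` rounds, each of which avoids some page, costs at most `T + k`. -/
theorem optCost_flatten_le [Fintype P] (hP : Fintype.card P = k + 1) (L : List (List P))
    (hL : ∀ τ ∈ L, ∃ q, q ∉ τ) : optCost k L.flatten ≤ L.length + k := by
  -- The memory size is the potential: a round costs at most one fault more than the memory grows.
  suffices H : ∃ n S, CanServe k L.flatten n S ∧ n ≤ L.length + S.card by
    obtain ⟨n, S, h1, h2⟩ := H
    have h3 := h1.optCost_le
    obtain ⟨C, hC, -, rfl⟩ := h1
    have := hC.card_le
    omega
  induction L using List.reverseRecOn with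
  | nil => exact ⟨0, ∅, canServe_nil, by simp⟩
  | append_singleton L τ ih =>
    obtain ⟨n, S, h1, h2⟩ := ih fun τ hτ => hL τ (List.mem_append_left _ hτ)
    obtain ⟨q, hq⟩ := hL τ (by simp)
    obtain ⟨n', S', h3, h4⟩ := h1.append_of_notMem hP hq
    refine ⟨n', S', by simpa using h3, ?_⟩
    rw [List.length_append, List.length_singleton]
    omega

end Services

/-! ### Online algorithms and phases -/

section Phases

variable {V P : Type*} [DecidableEq P] {G : ExtendedAccessGraph V P} {k : ℕ}

namespace OnlineAlg

theorem faultCount_prefix (A : OnlineAlg G k) (σ τ : List V) :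
    faultCount (σ.map G.label) (fun i => A.serve ((σ ++ τ).take i)) = A.faults σ :=
  faultCount_congr fun i hi => by
    rw [List.length_map] at hi
    rw [List.take_append_of_le_length hi.le]

@[simp] theorem faults_nil (A : OnlineAlg G k) : A.faults [] = 0 := by
  simp [faults]

theorem faults_append_singleton (A : OnlineAlg G k) (σ : List V) (v : V) :
    A.faults (σ ++ [v]) = A.faults σ + if G.label v ∈ A.serve σ then 0 else 1 := by
  have h := A.faultCount_prefix σ [v]
  unfold faults at h ⊢
  rw [List.map_append, List.map_singleton, faultCount_append_singleton, h]
  simp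

@[simp] theorem serve_nil (A : OnlineAlg G k) : A.serve [] = ∅ := by
  simpa using (A.valid []).start

theorem card_serve_le (A : OnlineAlg G k) (σ : List V) : (A.serve σ).card ≤ k := by
  simpa using (A.valid σ).card_le

theorem faults_lt_of_mem (A : OnlineAlg G k) {σ τ : List V} {x : P} (hx : x ∉ A.serve σ)
    (hτ : x ∈ τ.map G.label) : A.faults σ < A.faults (σ ++ τ) := by
  have h := A.valid (σ ++ τ)
  rw [List.map_append] at h
  have := h.faultCount_lt_of_mem (by simpa using hx) hτ
  rwa [faultCount_prefix, ← List.map_append] at this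

theorem faults_le_append (A : OnlineAlg G k) (σ τ : List V) :
    A.faults σ ≤ A.faults (σ ++ τ) := by
  have := faultCount_le_append (ρ := σ.map G.label) (τ := τ.map G.label)
    (fun i => A.serve ((σ ++ τ).take i))
  rwa [faultCount_prefix, ← List.map_append] at this

theorem optCost_le_faults (A : OnlineAlg G k) (σ : List V) :
    optCost k (σ.map G.label) ≤ A.faults σ :=
  (A.valid σ).optCost_le

end OnlineAlg

namespace ExtendedAccessGraph

theorem toFinset_map_append_singleton (σ : List V) (v : V) :
    ((σ ++ [v]).map G.label).toFinset = insert (G.label v) (σ.map G.label).toFinset := by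
  ext; simp

@[simp] theorem currentPhase_nil : G.currentPhase k [] = [] := rfl

theorem currentPhase_append_singleton (σ : List V) (v : V) :
    G.currentPhase k (σ ++ [v]) =
      if (insert (G.label v) (G.marked k σ)).card ≤ k then G.currentPhase k σ ++ [v] else [v] := by
  rw [marked, ← toFinset_map_append_singleton]
  simp [currentPhase]

theorem marked_append_singleton (σ : List V) (v : V) :
    G.marked k (σ ++ [v]) =
      if (insert (G.label v) (G.marked k σ)).card ≤ k then insert (G.label v) (G.marked k σ)
      else {G.label v} := by
  rw [marked, currentPhase_append_singleton]
  split_ifs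
  · rw [toFinset_map_append_singleton, marked]
  · simp

theorem label_mem_marked_append_singleton (σ : List V) (v : V) :
    G.label v ∈ G.marked k (σ ++ [v]) := by
  rw [marked_append_singleton]
  split_ifs <;> simp

theorem card_marked_le (hk : 1 ≤ k) (σ : List V) : (G.marked k σ).card ≤ k := by
  cases σ using List.reverseRecOn with
  | nil => simp [marked]
  | append_singleton σ v =>
    rw [marked_append_singleton]
    split_ifs with h
    · exact h
    · simpa

theorem exists_eq_append_currentPhase (σ : List V) : ∃ pre, σ = pre ++ G.currentPhase k σ := by
  induction σ using List.reverseRecOn with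
  | nil => exact ⟨[], rfl⟩
  | append_singleton σ v ih =>
    rw [currentPhase_append_singleton]
    split_ifs
    · obtain ⟨pre, h⟩ := ih
      exact ⟨pre, by rw [← List.append_assoc, ← h]⟩
    · exact ⟨σ, rfl⟩

theorem currentPhase_ne_nil {σ : List V} (hσ : σ ≠ []) : G.currentPhase k σ ≠ [] := by
  cases σ using List.reverseRecOn with
  | nil => exact absurd rfl hσ
  | append_singleton σ v =>
    rw [currentPhase_append_singleton]
    split_ifs <;> simp

theorem isWalk_currentPhase {σ : List V} (hσ : G.IsWalk σ) : G.IsWalk (G.currentPhase k σ) := by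
  obtain ⟨pre, h⟩ := exists_eq_append_currentPhase (G := G) (k := k) σ
  unfold IsWalk at hσ ⊢
  rw [h] at hσ
  exact hσ.right_of_append

/-- The number of phases that have ended before the last request, for a reversed sequence. -/
def phaseChangesReverse (G : ExtendedAccessGraph V P) (k : ℕ) : List V → ℕ
  | [] => 0
  | v :: τ => phaseChangesReverse G k τ +
      if (insert (G.label v) (G.marked k τ.reverse)).card ≤ k then 0 else 1

/-- The number of requests that begin a new phase, other than the very first request. -/
def phaseChanges (G : ExtendedAccessGraph V P) (k : ℕ) (σ : List V) : ℕ :=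
  G.phaseChangesReverse k σ.reverse

theorem phaseChanges_append_singleton (σ : List V) (v : V) :
    G.phaseChanges k (σ ++ [v]) = G.phaseChanges k σ +
      if (insert (G.label v) (G.marked k σ)).card ≤ k then 0 else 1 := by
  simp [phaseChanges, phaseChangesReverse]

/-- Every service has a fault between the second request of a phase and the first request of
the next one. -/
theorem phaseChanges_le_faultCount {σ : List V} {C : ℕ → Finset P}
    (h : IsService k (σ.map G.label) C) :
    G.phaseChanges k σ ≤ faultCount (σ.map G.label) C := by
  -- `S` is the memory right after the request that opened the current phase (empty in the first
  -- phase). Each marked page outside `S` has cost a fault within the phase.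
  suffices H : ∃ S : Finset P, S.card ≤ k ∧ C σ.length ⊆ S ∪ G.marked k σ ∧
      G.phaseChanges k σ + (G.marked k σ \ S).card ≤ faultCount (σ.map G.label) C by
    obtain ⟨S, -, -, h⟩ := H
    omega
  induction σ using List.reverseRecOn with
  | nil => exact ⟨∅, by simp, by simp [h.start], by simp [phaseChanges, phaseChangesReverse, marked]⟩
  | append_singleton σ v ih =>
    rw [List.map_append, List.map_singleton] at h ⊢
    obtain ⟨h1, h2, h3, h4⟩ := isService_append_singleton.1 h
    rw [List.length_map] at h2 h3 h4
    obtain ⟨S, i1, i2, i3⟩ := ih h1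
    have hstep : G.phaseChanges k σ + (insert (G.label v) (G.marked k σ) \ S).card ≤
        faultCount (σ.map G.label ++ [G.label v]) C := by
      rw [faultCount_append_singleton, List.length_map]
      by_cases hv : G.label v ∈ C σ.length
      · rw [if_pos hv]
        have : insert (G.label v) (G.marked k σ) \ S = G.marked k σ \ S := by
          have := i2 hv
          ext x
          simp only [Finset.mem_sdiff, Finset.mem_insert, Finset.mem_union] at this ⊢
          grind
        rw [this]
        omega
      · rw [if_neg hv]
        have : insert (G.label v) (G.marked k σ) \ S ⊆
            insert (G.label v) (G.marked k σ \ S) := by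
          intro x
          simp only [Finset.mem_sdiff, Finset.mem_insert]
          tauto
        have := (Finset.card_le_card this).trans (Finset.card_insert_le _ _)
        omega
    rw [phaseChanges_append_singleton, marked_append_singleton, List.length_append,
      List.length_singleton]
    split_ifs with hc
    · refine ⟨S, i1, ?_, by simpa using hstep⟩
      intro x hx
      have := h3 hx
      simp only [Finset.mem_insert, Finset.mem_union] at this ⊢
      rcases this with h | h
      · exact Or.inr (Or.inl h)
      · have := i2 h
        simp only [Finset.mem_union] at this
        tauto
    · refine ⟨C (σ.length + 1), h4, Finset.subset_union_left, ?_⟩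
      have e : {G.label v} \ C (σ.length + 1) = ∅ := by simpa using h2
      rw [e, Finset.card_empty]
      -- The marked pages together with the new one exceed `k`, so at least one is outside `S`; its
      -- fault pays for the phase change.
      have := Finset.le_card_sdiff S (insert (G.label v) (G.marked k σ))
      omega

theorem phaseChanges_le_optCost (hk : 1 ≤ k) (σ : List V) :
    G.phaseChanges k σ ≤ optCost k (σ.map G.label) := by
  obtain ⟨C, hC, h⟩ := exists_isService_eq_optCost hk (σ.map G.label)
  exact h ▸ phaseChanges_le_faultCount hC

end ExtendedAccessGraph

theorem card_toFinset_le_optCost (hk : 1 ≤ k) (ρ : List P) :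
    ρ.toFinset.card ≤ optCost k ρ := by
  obtain ⟨C, hC, h⟩ := exists_isService_eq_optCost hk ρ
  exact h ▸ hC.card_toFinset_le

end Phases

/-! ### Segments of a path and the orders `≺_i` -/

section PathGeometry

variable {m : ℕ} {P : Type*}

/-- The vertex `x` lies on the path from `i` to `u`. -/
def OnSegment (i x u : Fin m) : Prop :=
  (i ≤ x ∧ x ≤ u) ∨ (u ≤ x ∧ x ≤ i)

/-- A step changes the index by one, so a walk cannot jump over `x`. -/
theorem mem_support_of_onSegment {i u : Fin m} (w : (SimpleGraph.pathGraph m).Walk i u)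
    {x : Fin m} (h : OnSegment i x u) : x ∈ w.support := by
  induction w with
  | nil =>
    unfold OnSegment at h
    rw [SimpleGraph.Walk.support_nil, List.mem_singleton]
    omega
  | @cons a b c hadj w ih =>
    rw [SimpleGraph.pathGraph_adj] at hadj
    rw [SimpleGraph.Walk.support_cons, List.mem_cons]
    unfold OnSegment at h ih
    by_cases hx : x = a
    · exact Or.inl hx
    · right
      apply ih
      omega

theorem exists_walk_of_le {i u : Fin m} (h : i ≤ u) :
    ∃ w : (SimpleGraph.pathGraph m).Walk i u, ∀ x ∈ w.support, i ≤ x ∧ x ≤ u := by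
  obtain ⟨d, hd⟩ : ∃ d : ℕ, (u : ℕ) = i + d := ⟨u - i, by omega⟩
  induction d generalizing u with
  | zero =>
    obtain rfl : u = i := Fin.ext hd
    exact ⟨SimpleGraph.Walk.nil, by simp⟩
  | succ d ih =>
    obtain ⟨w, hw⟩ := ih (u := ⟨i + d, by omega⟩) (Fin.le_def.2 (by simp)) rfl
    have hadj : (SimpleGraph.pathGraph m).Adj ⟨i + d, by omega⟩ u := by
      rw [SimpleGraph.pathGraph_adj]
      left
      simp only
      omega
    refine ⟨w.concat hadj, fun x hx => ?_⟩
    rw [SimpleGraph.Walk.support_concat, List.mem_append,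
      List.mem_singleton] at hx
    rcases hx with hx | rfl
    · have := hw x hx
      simp only [Fin.le_def] at this ⊢
      omega
    · exact ⟨h, le_rfl⟩

theorem exists_walk_onSegment (i u : Fin m) :
    ∃ w : (SimpleGraph.pathGraph m).Walk i u, ∀ x ∈ w.support, OnSegment i x u := by
  rcases le_total i u with h | h
  · obtain ⟨w, hw⟩ := exists_walk_of_le h
    exact ⟨w, fun x hx => Or.inl (hw x hx)⟩
  · obtain ⟨w, hw⟩ := exists_walk_of_le h
    exact ⟨w.reverse, fun x hx => Or.inr (hw x (by simpa using hx))⟩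

/-- The vertices of a walk of requests that starts at `i` form a segment around `i`. -/
theorem IsWalk.mem_of_onSegment {ℓ : Fin m → P} {i : Fin m} {σ : List (Fin m)}
    (h : (pathEAG ℓ).IsWalk (i :: σ)) {x u : Fin m} (hu : u ∈ i :: σ) (hx : OnSegment i x u) :
    x ∈ i :: σ := by
  unfold ExtendedAccessGraph.IsWalk at h
  unfold OnSegment at hx
  induction σ generalizing i with
  | nil =>
    rw [List.mem_singleton] at hu ⊢
    omega
  | cons j σ ih =>
    rw [List.isChain_cons_cons] at h
    obtain ⟨hij, h⟩ := h
    have hij : i = j ∨ (i : ℕ) + 1 = j ∨ (j : ℕ) + 1 = i := by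
      rcases hij with rfl | hij
      · exact Or.inl rfl
      · exact Or.inr (SimpleGraph.pathGraph_adj.1 hij)
    rw [List.mem_cons]
    by_cases hxi : x = i
    · exact Or.inl hxi
    · right
      rcases List.mem_cons.1 hu with rfl | hu
      · omega
      · exact ih h hu (by omega)

/-- No vertex on the way from `i` to `u` is labeled `p`. -/
def ClearOf (ℓ : Fin m → P) (i : Fin m) (p : P) (u : Fin m) : Prop :=
  ∀ x, OnSegment i x u → ℓ x ≠ p

theorem ClearOf.of_onSegment {ℓ : Fin m → P} {i x u : Fin m} {p : P} (h : ClearOf ℓ i p u)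
    (hx : OnSegment i x u) : ClearOf ℓ i p x := by
  intro y hy
  apply h
  unfold OnSegment at *
  omega

/-- Every walk from `i` to `u` covers the segment between them and some walk covers nothing else, so
the order depends on segments only. -/
theorem precedes_iff {ℓ : Fin m → P} {i : Fin m} {p q : P} :
    (pathEAG ℓ).Precedes i p q ↔ ∀ u, ℓ u = q → ¬ ClearOf ℓ i p u := by
  constructor
  · intro h u hu hc
    obtain ⟨w, hw⟩ := exists_walk_onSegment i u
    obtain ⟨x, hx, hxp⟩ := h u w hu
    exact hc x (hw x hx) hxp
  · intro h u w hu
    have := h u hu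
    unfold ClearOf at this
    push Not at this
    obtain ⟨x, hx, hxp⟩ := this
    exact ⟨x, mem_support_of_onSegment w hx, hxp⟩

theorem LeftBefore.trans {ℓ : Fin m → P} {i : Fin m} {p q r : P} (h : LeftBefore ℓ i p q)
    (h' : LeftBefore ℓ i q r) : LeftBefore ℓ i p r := by
  obtain ⟨a, ha, hp, hq⟩ := h
  obtain ⟨b, hb, hq', hr⟩ := h'
  refine ⟨a, ha, hp, fun c hc hci => hr c ?_ hci⟩
  by_contra hbc
  exact hq b (by omega) hb hq'

theorem LeftBefore.asymm {ℓ : Fin m → P} {i : Fin m} {p q : P} (h : LeftBefore ℓ i p q) :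
    ¬ LeftBefore ℓ i q p := by
  intro h'
  obtain ⟨a, ha, hp, hc⟩ := h.trans h'
  exact hc a le_rfl ha hp

open scoped Classical in
/-- The number of vertices on the left of `i` that are closer to `i` than any vertex on the left
labeled `p`. -/
noncomputable def leftKey (ℓ : Fin m → P) (i : Fin m) (p : P) : ℕ :=
  (Finset.univ.filter fun a => a < i ∧ ∀ b, a ≤ b → b < i → ℓ b ≠ p).card

theorem LeftBefore.leftKey_lt {ℓ : Fin m → P} {i : Fin m} {p q : P}
    (h : LeftBefore ℓ i p q) : leftKey ℓ i p < leftKey ℓ i q := by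
  obtain ⟨a, ha, hp, hq⟩ := h
  refine Finset.card_lt_card (Finset.ssubset_iff_of_subset ?_ |>.2 ⟨a, ?_, ?_⟩)
  · intro b
    simp only [Finset.mem_filter, Finset.mem_univ, true_and]
    rintro ⟨hb, hbp⟩
    refine ⟨hb, fun c hbc hci => hq c ?_ hci⟩
    by_contra hac
    exact hbp a (by omega) ha hp
  · simpa using ⟨ha, hq⟩
  · simp only [Finset.mem_filter, Finset.mem_univ, true_and, not_and]
    intro _ h
    exact h a le_rfl ha hp

variable [Fintype P] [DecidableEq P]

/-- The working form of maximality: the occurrences of `p` nearest to `i` cut off no other page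
completely. -/
theorem mem_maximalPages_iff {ℓ : Fin m → P} {i : Fin m} {p : P} :
    p ∈ (pathEAG ℓ).maximalPages i ↔ ∀ q, q ≠ p → ∃ u, ℓ u = q ∧ ClearOf ℓ i p u := by
  simp only [ExtendedAccessGraph.maximalPages, Finset.mem_filter, Finset.mem_univ, true_and,
    precedes_iff]
  constructor
  · intro h q hq
    by_contra! hc
    exact hq (h q hc)
  · intro h q hq
    by_contra hne
    obtain ⟨u, hu, hc⟩ := h q hne
    exact hq u hu hc

theorem label_notMem_maximalPages [Nontrivial P] (ℓ : Fin m → P) (i : Fin m) :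
    ℓ i ∉ (pathEAG ℓ).maximalPages i := by
  intro h
  obtain ⟨q, hq⟩ := exists_ne (ℓ i)
  obtain ⟨u, -, hc⟩ := mem_maximalPages_iff.1 h q hq
  exact hc i (by unfold OnSegment; omega) rfl

/-- Of two maximal pages, the one that is met first on the left is met last on the right. -/
theorem LeftBefore.exists_right {ℓ : Fin m → P} {i : Fin m} {p q : P}
    (h : LeftBefore ℓ i p q) (hp : p ∈ (pathEAG ℓ).maximalPages i) :
    ∃ u, i ≤ u ∧ ℓ u = q ∧ ClearOf ℓ i p u := by
  have hne : q ≠ p := by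
    rintro rfl
    exact h.asymm h
  obtain ⟨u, hu, hc⟩ := mem_maximalPages_iff.1 hp q hne
  refine ⟨u, ?_, hu, hc⟩
  by_contra hui
  obtain ⟨a, ha, hpa, hqa⟩ := h
  by_cases hau : a ≤ u
  · exact hqa u hau (by omega) hu
  · exact hc a (Or.inr ⟨by omega, ha.le⟩) hpa

/-- Maximality gives an occurrence of each page clear of the other. If both were on the right, the
nearer one would lie on the way to the farther one; so one is on the left, and it decides the order.
-/
theorem leftBefore_total [Nontrivial P] {ℓ : Fin m → P} {i : Fin m} {p q : P}
    (hp : p ∈ (pathEAG ℓ).maximalPages i) (hq : q ∈ (pathEAG ℓ).maximalPages i) (hne : p ≠ q) :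
    LeftBefore ℓ i p q ∨ LeftBefore ℓ i q p := by
  obtain ⟨u, hu, hcu⟩ := mem_maximalPages_iff.1 hp q hne.symm
  obtain ⟨v, hv, hcv⟩ := mem_maximalPages_iff.1 hq p hne
  have hui : u ≠ i := by
    rintro rfl
    exact label_notMem_maximalPages ℓ u (hu ▸ hq)
  have hvi : v ≠ i := by
    rintro rfl
    exact label_notMem_maximalPages ℓ v (hv ▸ hp)
  by_cases h1 : u < i
  · exact Or.inr ⟨u, h1, hu, fun b hub hbi => hcu b (Or.inr ⟨hub, hbi.le⟩)⟩
  by_cases h2 : v < i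
  · exact Or.inl ⟨v, h2, hv, fun b hvb hbi => hcv b (Or.inr ⟨hvb, hbi.le⟩)⟩
  exfalso
  rcases le_total u v with h | h
  · exact hcv u (Or.inl ⟨by omega, h⟩) hu
  · exact hcu v (Or.inl ⟨by omega, h⟩) hv

/-- Turns the left order on `M_i` into a numerical one, so that sets of maximal pages can be split
by rank. -/
theorem leftKey_lt_iff [Nontrivial P] {ℓ : Fin m → P} {i : Fin m} {p q : P}
    (hp : p ∈ (pathEAG ℓ).maximalPages i) (hq : q ∈ (pathEAG ℓ).maximalPages i) :
    leftKey ℓ i p < leftKey ℓ i q ↔ LeftBefore ℓ i p q := by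
  refine ⟨fun h => ?_, LeftBefore.leftKey_lt⟩
  have hne : p ≠ q := by
    rintro rfl
    exact lt_irrefl _ h
  exact (leftBefore_total hp hq hne).resolve_right fun h' => h.asymm h'.leftKey_lt

theorem leftKey_injOn [Nontrivial P] (ℓ : Fin m → P) (i : Fin m) :
    Set.InjOn (leftKey ℓ i) ((pathEAG ℓ).maximalPages i) := by
  intro p hp q hq h
  by_contra hne
  rcases leftBefore_total hp hq hne with h' | h'
  · exact h'.leftKey_lt.ne h
  · exact h'.leftKey_lt.ne' h

/-- At most two maximal pages fail to appear on both sides. -/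
theorem card_maximalPages_oneSided_le {ℓ : Fin m → P} (i : Fin m)
    (S : Finset P) (hS : ∀ p ∈ S, p ∈ (pathEAG ℓ).maximalPages i ∧ ¬ OnBothSides ℓ i p) :
    S.card ≤ 2 := by
  classical
  -- Of two pages absent on the left, the one met first on the right would precede the other,
  -- against maximality.
  have hL : ((S.filter fun p => ¬ ∃ a, a < i ∧ ℓ a = p)).card ≤ 1 := by
    rw [Finset.card_le_one]
    intro p hp q hq
    simp only [Finset.mem_filter, not_exists, not_and] at hp hq
    by_contra hne
    obtain ⟨u, hu, hcu⟩ := mem_maximalPages_iff.1 (hS p hp.1).1 q (Ne.symm hne)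
    obtain ⟨v, hv, hcv⟩ := mem_maximalPages_iff.1 (hS q hq.1).1 p hne
    have h1 : ¬ u < i := fun h => hq.2 u h hu
    have h2 : ¬ v < i := fun h => hp.2 v h hv
    rcases le_total u v with h | h
    · exact hcv u (Or.inl ⟨by omega, h⟩) hu
    · exact hcu v (Or.inl ⟨by omega, h⟩) hv
  have hR : ((S.filter fun p => ¬ ∃ b, i < b ∧ ℓ b = p)).card ≤ 1 := by
    rw [Finset.card_le_one]
    intro p hp q hq
    simp only [Finset.mem_filter, not_exists, not_and] at hp hq
    by_contra hne
    obtain ⟨u, hu, hcu⟩ := mem_maximalPages_iff.1 (hS p hp.1).1 q (Ne.symm hne)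
    obtain ⟨v, hv, hcv⟩ := mem_maximalPages_iff.1 (hS q hq.1).1 p hne
    have h1 : ¬ i < u := fun h => hq.2 u h hu
    have h2 : ¬ i < v := fun h => hp.2 v h hv
    rcases le_total u v with h | h
    · exact hcu v (Or.inr ⟨h, by omega⟩) hv
    · exact hcv u (Or.inr ⟨h, by omega⟩) hu
  have hsub : S ⊆ (S.filter fun p => ¬ ∃ a, a < i ∧ ℓ a = p) ∪
      (S.filter fun p => ¬ ∃ b, i < b ∧ ℓ b = p) := by
    intro p hp
    have := (hS p hp).2
    rw [OnBothSides, not_and_or] at this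
    simp only [Finset.mem_union, Finset.mem_filter]
    tauto
  have := (Finset.card_le_card hsub).trans (Finset.card_union_le _ _)
  omega

/-- Some page outside `D` is maximal, if `D` is closed under going down in the order. -/
theorem exists_mem_maximalPages_notMem {ℓ : Fin m → P} (hℓ : Function.Surjective ℓ) {i : Fin m}
    {D : Finset P} (hD : ∀ p q, (pathEAG ℓ).Precedes i p q → q ∈ D → p ∈ D)
    (hne : ∃ p, p ∉ D) : ∃ p ∈ (pathEAG ℓ).maximalPages i, p ∉ D := by
  classical
  -- The number of vertices reachable without meeting `p` increases strictly along the order, so a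
  -- maximizer outside `D` is maximal.
  let key : P → ℕ := fun p => (Finset.univ.filter fun u => ClearOf ℓ i p u).card
  obtain ⟨p, hp, hmax⟩ := Finset.exists_max_image (Finset.univ.filter fun p => p ∉ D) key
    (by simpa [Finset.Nonempty] using hne)
  simp only [Finset.mem_filter, Finset.mem_univ, true_and] at hp hmax
  refine ⟨p, ?_, hp⟩
  rw [ExtendedAccessGraph.maximalPages]
  simp only [Finset.mem_filter, Finset.mem_univ, true_and]
  intro q hpq
  by_contra hqp
  have hlt : key p < key q := by
    have hsub : ∀ u, ClearOf ℓ i p u → ClearOf ℓ i q u := by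
      intro u hu x hx hxq
      exact precedes_iff.1 hpq x hxq (hu.of_onSegment hx)
    -- A vertex labeled `p` or `q` nearest to `i` must carry `p`, since `p` precedes `q`. It is
    -- clear of `q` but not of `p`, which makes the increase strict.
    obtain ⟨u, hu, hmin⟩ := Finset.exists_min_image
      (Finset.univ.filter fun u : Fin m => ℓ u = p ∨ ℓ u = q)
      (fun u : Fin m => ((u : ℕ) - i) + ((i : ℕ) - u))
      (by
        obtain ⟨u, hu⟩ := hℓ p
        exact ⟨u, by simp [hu]⟩)
    simp only [Finset.mem_filter, Finset.mem_univ, true_and] at hu hmin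
    have hnear : ∀ x, OnSegment i x u → ℓ x = p ∨ ℓ x = q → x = u := by
      intro x hx hl
      have := hmin x hl
      unfold OnSegment at hx
      omega
    have hup : ℓ u = p := by
      rcases hu with hu | hu
      · exact hu
      · by_contra hup
        refine precedes_iff.1 hpq u hu fun x hx hxp => hup ?_
        rw [← hnear x hx (Or.inl hxp), hxp]
    refine Finset.card_lt_card (Finset.ssubset_iff_of_subset ?_ |>.2 ⟨u, ?_, ?_⟩)
    · intro u
      simpa using hsub u
    · simp only [Finset.mem_filter, Finset.mem_univ, true_and]
      intro x hx hxq
      have := hnear x hx (Or.inr hxq)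
      subst this
      exact hqp (hxq.symm.trans hup)
    · simp only [Finset.mem_filter, Finset.mem_univ, true_and]
      intro h
      exact h u (by unfold OnSegment; omega) hup
  exact absurd (hmax q fun hq => hp (hD p q hpq hq)) (not_le.2 hlt)

end PathGeometry

/-! ### Initial segments of a finite set ordered by a numerical key -/

section KeyOrder

variable {α : Type*} [DecidableEq α]

theorem exists_initial_subset_card_eq (key : α → ℕ) (X : Finset α) (hX : Set.InjOn key X) {t : ℕ}
    (ht : t ≤ X.card) :
    ∃ Y ⊆ X, Y.card = t ∧ ∀ y ∈ Y, ∀ z ∈ X \ Y, key y < key z := by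
  induction t with
  | zero => exact ⟨∅, by simp, by simp, by simp⟩
  | succ t ih =>
    obtain ⟨Y, hYX, hYc, hY⟩ := ih (by omega)
    have hne : (X \ Y).Nonempty := by
      rw [← Finset.card_pos, Finset.card_sdiff_of_subset hYX]
      omega
    obtain ⟨q, hq, hmin⟩ := Finset.exists_min_image (X \ Y) key hne
    have hq' := Finset.mem_sdiff.1 hq
    refine ⟨insert q Y, Finset.insert_subset hq'.1 hYX, ?_, ?_⟩
    · rw [Finset.card_insert_of_notMem hq'.2, hYc]
    · intro y hy z hz
      simp only [Finset.mem_sdiff, Finset.mem_insert, not_or] at hz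
      have hzX : z ∈ X \ Y := Finset.mem_sdiff.2 ⟨hz.1, hz.2.2⟩
      rcases Finset.mem_insert.1 hy with rfl | hy
      · exact lt_of_le_of_ne (hmin z hzX) fun h => hz.2.1 (hX hz.1 hq'.1 h.symm)
      · exact hY y hy z hzX

theorem exists_middle (key : α → ℕ) (X : Finset α) (hX : Set.InjOn key X) (hne : X.Nonempty) :
    ∃ q ∈ X, 2 * (X.filter fun p => key p < key q).card ≤ X.card ∧
      2 * (X.filter fun p => key q < key p).card ≤ X.card := by
  obtain ⟨Y, hYX, hYc, hY⟩ := exists_initial_subset_card_eq key X hX (t := X.card / 2) (by omega)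
  have hpos := hne.card_pos
  have hc := Finset.card_sdiff_of_subset hYX
  -- The middle element is the least one after the first `X.card / 2` are removed.
  obtain ⟨q, hq, hmin⟩ := Finset.exists_min_image (X \ Y) key (by
    rw [← Finset.card_pos]
    omega)
  refine ⟨q, (Finset.mem_sdiff.1 hq).1, ?_, ?_⟩
  · have : (X.filter fun p => key p < key q) ⊆ Y := by
      intro p hp
      rw [Finset.mem_filter] at hp
      by_contra hpY
      exact absurd (hmin p (Finset.mem_sdiff.2 ⟨hp.1, hpY⟩)) (not_le.2 hp.2)
    have := Finset.card_le_card this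
    omega
  · have : (X.filter fun p => key q < key p) ⊆ (X \ Y).erase q := by
      intro p hp
      rw [Finset.mem_filter] at hp
      refine Finset.mem_erase.2 ⟨?_, Finset.mem_sdiff.2 ⟨hp.1, fun hpY => ?_⟩⟩
      · rintro rfl
        exact lt_irrefl _ hp.2
      · exact (hY p hpY q hq).asymm hp.2
    have := Finset.card_le_card this
    rw [Finset.card_erase_of_mem hq] at this
    omega

end KeyOrder

/-! ### Closed walks and the random adversary -/

section Adversary

variable {m : ℕ} {P : Type*}

/-- A sequence of vertices that starts and ends at `i` (or is empty) and generates requests. -/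
structure LoopAt (ℓ : Fin m → P) (i : Fin m) (w : List (Fin m)) : Prop where
  isWalk : (pathEAG ℓ).IsWalk w
  head : ∀ x ∈ w.head?, x = i
  last : ∀ x ∈ w.getLast?, x = i

theorem loopAt_nil (ℓ : Fin m → P) (i : Fin m) : LoopAt ℓ i [] :=
  ⟨List.isChain_nil, by simp, by simp⟩

/-- At the junction `i` is requested twice in a row, which request sequences allow. -/
theorem LoopAt.append {ℓ : Fin m → P} {i : Fin m} {w w' : List (Fin m)} (h : LoopAt ℓ i w)
    (h' : LoopAt ℓ i w') : LoopAt ℓ i (w ++ w') := by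
  rcases w.eq_nil_or_concat with rfl | ⟨t, a, rfl⟩
  · simpa using h'
  rcases w' with - | ⟨b, t'⟩
  · simpa using h
  refine ⟨?_, fun x hx => h.head x ?_, fun x hx => h'.last x ?_⟩
  · refine List.isChain_append.2 ⟨h.isWalk, h'.isWalk, fun x hx y hy => ?_⟩
    rw [h.last x hx, h'.head y hy]
    exact Or.inl rfl
  · simpa [List.head?_append] using hx
  · simpa [List.getLast?_append] using hx

/-- A walk to `u` and back. -/
theorem exists_loopAt (ℓ : Fin m → P) (i u : Fin m) :
    ∃ w, LoopAt ℓ i w ∧ u ∈ w ∧ ∀ x ∈ w, OnSegment i x u := by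
  obtain ⟨c, hc⟩ := exists_walk_onSegment i u
  have hch : ∀ {a b : Fin m} (c : (SimpleGraph.pathGraph m).Walk a b),
      (pathEAG ℓ).IsWalk c.support := fun c =>
    (SimpleGraph.Walk.isChain_adj_support c).imp fun _ _ h => Or.inr h
  refine ⟨c.support ++ c.reverse.support, ⟨?_, ?_, ?_⟩, by simp, ?_⟩
  · refine List.isChain_append.2 ⟨hch c, hch c.reverse, fun x hx y hy => Or.inl ?_⟩
    rw [List.getLast?_eq_getLast_of_ne_nil c.support_ne_nil] at hx
    rw [List.head?_eq_some_head c.reverse.support_ne_nil] at hy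
    rw [SimpleGraph.Walk.getLast_support, Option.mem_some_iff] at hx
    rw [SimpleGraph.Walk.head_support, Option.mem_some_iff] at hy
    exact hx.symm.trans hy
  · intro x hx
    rw [← c.cons_tail_support, List.cons_append, List.head?_cons] at hx
    exact (Option.mem_some_iff.1 hx).symm
  · intro x hx
    rw [List.getLast?_append_of_ne_nil _ c.reverse.support_ne_nil,
      List.getLast?_eq_getLast_of_ne_nil c.reverse.support_ne_nil,
      SimpleGraph.Walk.getLast_support] at hx
    exact (Option.mem_some_iff.1 hx).symm
  · intro x hx
    simp at hx
    exact hc x hx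

/-- A closed walk that visits all the vertices of `F`. -/
theorem exists_loopAt_cover (ℓ : Fin m → P) (i : Fin m) (F : Finset (Fin m)) :
    ∃ w, LoopAt ℓ i w ∧ (∀ u ∈ F, u ∈ w) ∧ ∀ x ∈ w, ∃ u ∈ F, OnSegment i x u := by
  induction F using Finset.induction_on with
  | empty => exact ⟨[], loopAt_nil ℓ i, by simp, by simp⟩
  | insert u F _ ih =>
    obtain ⟨w, h1, h2, h3⟩ := ih
    obtain ⟨w', h1', h2', h3'⟩ := exists_loopAt ℓ i u
    refine ⟨w ++ w', h1.append h1', ?_, ?_⟩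
    · intro x hx
      rcases Finset.mem_insert.1 hx with rfl | hx
      · exact List.mem_append_right _ h2'
      · exact List.mem_append_left _ (h2 x hx)
    · intro x hx
      rcases List.mem_append.1 hx with hx | hx
      · obtain ⟨v, hv, hxv⟩ := h3 x hx
        exact ⟨v, Finset.mem_insert_of_mem hv, hxv⟩
      · exact ⟨u, Finset.mem_insert_self _ _, h3' x hx⟩

variable [Fintype P] [DecidableEq P]

/-- Going left, `q` is met only beyond the first occurrence of `p`. Maximality of `q` is needed only
to exclude `q` at `i` itself. -/
theorem ClearOf.of_leftBefore_left [Nontrivial P] {ℓ : Fin m → P} {i u : Fin m} {p q : P}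
    (h : ClearOf ℓ i p u) (hu : u ≤ i) (hpq : LeftBefore ℓ i p q)
    (hq : q ∈ (pathEAG ℓ).maximalPages i) : ClearOf ℓ i q u := by
  intro x hx hxq
  have hxi : x ≠ i := by
    rintro rfl
    exact label_notMem_maximalPages ℓ x (hxq ▸ hq)
  obtain ⟨a, ha, hap, hclear⟩ := hpq
  unfold OnSegment at hx
  have hxa : x < a := by
    by_contra hxa
    exact hclear x (by omega) (by omega) hxq
  exact h a (Or.inr ⟨by omega, by omega⟩) hap

/-- The mirror image: on the right the order of maximal pages is reversed, so avoiding `q` implies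
avoiding `p`. -/
theorem ClearOf.of_leftBefore_right {ℓ : Fin m → P} {i u : Fin m} {p q : P}
    (h : ClearOf ℓ i q u) (hu : i ≤ u) (hpq : LeftBefore ℓ i p q)
    (hp : p ∈ (pathEAG ℓ).maximalPages i) : ClearOf ℓ i p u := by
  obtain ⟨v, hv, hvq, hc⟩ := hpq.exists_right hp
  have huv : u < v := by
    by_contra huv
    exact h v (Or.inl ⟨hv, by omega⟩) hvq
  exact hc.of_onSegment (Or.inl ⟨hu, huv.le⟩)

/-- If the maximal pages of `S₁` are met on the left before those of `S₂`, then every page can be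
reached without meeting `S₁` or without meeting `S₂`. -/
theorem exists_clearOf_or [Nontrivial P] {ℓ : Fin m → P} {i : Fin m} {S₁ S₂ : Finset P}
    (h₁ : S₁ ⊆ (pathEAG ℓ).maximalPages i) (h₂ : S₂ ⊆ (pathEAG ℓ).maximalPages i)
    (hne₁ : S₁.Nonempty) (hne₂ : S₂.Nonempty)
    (hlt : ∀ p ∈ S₁, ∀ q ∈ S₂, leftKey ℓ i p < leftKey ℓ i q) (x : P) :
    (∃ u, ℓ u = x ∧ ∀ p ∈ S₁, ClearOf ℓ i p u) ∨ ∃ u, ℓ u = x ∧ ∀ q ∈ S₂, ClearOf ℓ i q u := by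
  -- `p` is the last page of `S₁` in the left order and `q` the first of `S₂`. A page other than `p`
  -- has an occurrence clear of `p`: on the right this avoids all of `S₁`, on the left all of `S₂`.
  -- The page `p` itself is reached on the left before `S₂`.
  obtain ⟨p, hp, hmax⟩ := Finset.exists_max_image S₁ (leftKey ℓ i) hne₁
  obtain ⟨q, hq, hmin⟩ := Finset.exists_min_image S₂ (leftKey ℓ i) hne₂
  have hpM := h₁ hp
  have hqM := h₂ hq
  have hlb : ∀ q ∈ S₂, LeftBefore ℓ i p q := fun q hq =>
    (leftKey_lt_iff hpM (h₂ hq)).1 (hlt p hp q hq)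
  by_cases hx : x = p
  · right
    obtain ⟨a, ha, hap, hclear⟩ := hlb q hq
    have hca : ClearOf ℓ i q a := by
      intro y hy hyq
      have hyi : y ≠ i := by
        rintro rfl
        exact label_notMem_maximalPages ℓ y (hyq ▸ hqM)
      unfold OnSegment at hy
      exact hclear y (by omega) (by omega) hyq
    refine ⟨a, hap.trans hx.symm, fun r hr => ?_⟩
    by_cases hrq : r = q
    · exact hrq ▸ hca
    · refine hca.of_leftBefore_left ha.le ?_ (h₂ hr)
      refine (leftKey_lt_iff hqM (h₂ hr)).1 (lt_of_le_of_ne (hmin r hr) fun h => hrq ?_)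
      exact (leftKey_injOn ℓ i hqM (h₂ hr) h).symm
  · obtain ⟨u, hu, hc⟩ := mem_maximalPages_iff.1 hpM x hx
    rcases le_total i u with hiu | hui
    · left
      refine ⟨u, hu, fun r hr => ?_⟩
      by_cases hrp : r = p
      · exact hrp ▸ hc
      · refine hc.of_leftBefore_right hiu ?_ (h₁ hr)
        refine (leftKey_lt_iff (h₁ hr) hpM).1 (lt_of_le_of_ne (hmax r hr) fun h => hrp ?_)
        exact leftKey_injOn ℓ i (h₁ hr) hpM h
    · right
      exact ⟨u, hu, fun r hr => hc.of_leftBefore_left hui (hlb r hr) (h₂ hr)⟩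

/-- A closed walk that meets no page of `S` and all the pages that can be reached that way. -/
theorem exists_loopAt_clearOf (ℓ : Fin m → P) (i : Fin m) (S : Finset P) :
    ∃ w, LoopAt ℓ i w ∧ (∀ p ∈ S, p ∉ w.map ℓ) ∧
      ∀ u, (∀ p ∈ S, ClearOf ℓ i p u) → ℓ u ∈ w.map ℓ := by
  classical
  obtain ⟨w, h1, h2, h3⟩ := exists_loopAt_cover ℓ i
    (Finset.univ.filter fun u => ∀ p ∈ S, ClearOf ℓ i p u)
  refine ⟨w, h1, fun p hp hpw => ?_, fun u hu => ?_⟩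
  · obtain ⟨x, hx, hxp⟩ := List.mem_map.1 hpw
    obtain ⟨u, hu, hxu⟩ := h3 x hx
    exact (Finset.mem_filter.1 hu).2 p hp x hxu hxp
  · exact List.mem_map_of_mem (h2 u (by simpa using hu))

/-- One round of the adversary: closed walks at `i`, one for each page of `S`, that avoid this
page and on average cost every algorithm half a fault for each halving of `S`. -/
theorem exists_round {k : ℕ} (hP : Fintype.card P = k + 1) [Nontrivial P] (ℓ : Fin m → P)
    (i : Fin m) (d : ℕ) (S : Finset P) (hS : S ⊆ (pathEAG ℓ).maximalPages i)
    (hd : S.card = 2 ^ d) :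
    ∃ W : P → List (Fin m), (∀ p ∈ S, LoopAt ℓ i (W p)) ∧ (∀ p ∈ S, p ∉ (W p).map ℓ) ∧
      ∀ (A : OnlineAlg (pathEAG ℓ) k) (τ : List (Fin m)),
        2 ^ d * (2 * A.faults τ + d) ≤ ∑ p ∈ S, 2 * A.faults (τ ++ W p) := by
  induction d generalizing S with
  | zero => exact ⟨fun _ => [], fun _ _ => loopAt_nil ℓ i, by simp, by simp [hd]⟩
  | succ d ih =>
    have hpow : 0 < 2 ^ d := by positivity
    rw [pow_succ] at hd
    -- The lower half of `S` in the left order.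
    obtain ⟨S₁, hsub, hc₁, hlt⟩ := exists_initial_subset_card_eq (leftKey ℓ i) S
      ((leftKey_injOn ℓ i).mono (by exact_mod_cast hS)) (t := 2 ^ d) (by omega)
    have hc₂ : (S \ S₁).card = 2 ^ d := by
      rw [Finset.card_sdiff_of_subset hsub]
      omega
    have hS₂ : S \ S₁ ⊆ S := Finset.sdiff_subset
    obtain ⟨W₁, a1, a2, a3⟩ := ih S₁ (hsub.trans hS) hc₁
    obtain ⟨W₂, b1, b2, b3⟩ := ih (S \ S₁) (hS₂.trans hS) hc₂
    obtain ⟨w₁, c1, c2, c3⟩ := exists_loopAt_clearOf ℓ i S₁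
    obtain ⟨w₂, e1, e2, e3⟩ := exists_loopAt_clearOf ℓ i (S \ S₁)
    -- The walk for `p` first avoids the whole half containing `p`, then continues with the round
    -- inside that half. It does not depend on the algorithm.
    refine ⟨fun p => if p ∈ S₁ then w₁ ++ W₁ p else w₂ ++ W₂ p, fun p hp => ?_, fun p hp => ?_,
      fun A τ => ?_⟩
    · beta_reduce
      by_cases h : p ∈ S₁
      · rw [if_pos h]
        exact c1.append (a1 p h)
      · rw [if_neg h]
        exact e1.append (b1 p (Finset.mem_sdiff.2 ⟨hp, h⟩))
    · beta_reduce
      by_cases h : p ∈ S₁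
      · rw [if_pos h, List.map_append, List.mem_append, not_or]
        exact ⟨c2 p h, a2 p h⟩
      · have h' := Finset.mem_sdiff.2 ⟨hp, h⟩
        rw [if_neg h, List.map_append, List.mem_append, not_or]
        exact ⟨e2 p h', b2 p h'⟩
    · obtain ⟨x, hx⟩ : ∃ x, x ∉ A.serve τ := by
        by_contra! hall
        have := Finset.card_le_card (fun x _ => hall x : Finset.univ ⊆ A.serve τ)
        have := A.card_serve_le τ
        rw [Finset.card_univ] at *
        omega
      -- The missing page `x` is requested in `w₁` or in `w₂`; the halves being equal in size, the
      -- gain is half a fault on average.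
      have hsum : 2 * A.faults τ + 1 ≤ A.faults (τ ++ w₁) + A.faults (τ ++ w₂) := by
        have f1 := A.faults_le_append τ w₁
        have f2 := A.faults_le_append τ w₂
        rcases exists_clearOf_or (hsub.trans hS) (hS₂.trans hS)
          (Finset.card_pos.1 (hc₁ ▸ hpow)) (Finset.card_pos.1 (hc₂ ▸ hpow)) hlt x with
          ⟨u, rfl, hu⟩ | ⟨u, rfl, hu⟩
        · have := A.faults_lt_of_mem hx (c3 u hu)
          omega
        · have := A.faults_lt_of_mem hx (e3 u hu)
          omega
      rw [← Finset.sum_sdiff hsub]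
      have g1 : ∑ p ∈ S₁, 2 * A.faults (τ ++ if p ∈ S₁ then w₁ ++ W₁ p else w₂ ++ W₂ p) =
          ∑ p ∈ S₁, 2 * A.faults (τ ++ w₁ ++ W₁ p) :=
        Finset.sum_congr rfl fun p hp => by rw [if_pos hp, List.append_assoc]
      have g2 : ∑ p ∈ S \ S₁, 2 * A.faults (τ ++ if p ∈ S₁ then w₁ ++ W₁ p else w₂ ++ W₂ p) =
          ∑ p ∈ S \ S₁, 2 * A.faults (τ ++ w₂ ++ W₂ p) :=
        Finset.sum_congr rfl fun p hp => by
          rw [if_neg (Finset.mem_sdiff.1 hp).2, List.append_assoc]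
      rw [g1, g2]
      refine le_trans ?_ (add_le_add (b3 A (τ ++ w₂)) (a3 A (τ ++ w₁)))
      rw [← mul_add, pow_succ, mul_assoc]
      exact Nat.mul_le_mul_left _ (by omega)

end Adversary

/-! ### Expected faults -/

section Expectation

variable {V P : Type*} [DecidableEq P] {G : ExtendedAccessGraph V P} {k : ℕ}

theorem OnlineAlg.measurableSet_mem_serve (p : P) (σ : List V) :
    MeasurableSet {A : OnlineAlg G k | p ∈ A.serve σ} :=
  le_iSup (fun σ : List V =>
    MeasurableSpace.comap (fun A : OnlineAlg G k => A.serve σ) ⊤) σ _ ⟨{S | p ∈ S}, trivial, rfl⟩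

theorem OnlineAlg.measurable_faults (σ : List V) :
    Measurable fun A : OnlineAlg G k => (A.faults σ : ℝ≥0∞) := by
  induction σ using List.reverseRecOn with
  | nil => simp
  | append_singleton σ v ih =>
    simp only [OnlineAlg.faults_append_singleton, Nat.cast_add, Nat.cast_ite]
    exact ih.add (Measurable.ite (OnlineAlg.measurableSet_mem_serve _ _) measurable_const
      measurable_const)

theorem optCost_le_expectedFaults (μ : MeasureTheory.ProbabilityMeasure (OnlineAlg G k))
    (σ : List V) : (optCost k (σ.map G.label) : ℝ≥0∞) ≤ expectedFaults μ σ := by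
  calc (optCost k (σ.map G.label) : ℝ≥0∞)
      = ∫⁻ _, (optCost k (σ.map G.label) : ℝ≥0∞)
          ∂(μ : MeasureTheory.Measure (OnlineAlg G k)) := by simp
    _ ≤ expectedFaults μ σ :=
        MeasureTheory.lintegral_mono fun A => Nat.cast_le.2 (A.optCost_le_faults σ)

/-- A lower bound for the average over `S` of the faults of every deterministic algorithm holds
for the expected faults at some member of `S`. -/
theorem exists_expectedFaults_ge {ι : Type*} (μ : MeasureTheory.ProbabilityMeasure (OnlineAlg G k))
    {S : Finset ι} (hS : S.Nonempty) (f : ι → List V) (τ : List V) (d : ℕ)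
    (h : ∀ A : OnlineAlg G k, S.card * (2 * A.faults τ + d) ≤ ∑ p ∈ S, 2 * A.faults (f p)) :
    ∃ p ∈ S, 2 * expectedFaults μ τ + d ≤ 2 * expectedFaults μ (f p) := by
  by_contra! hlt
  have hint : ∀ σ : List V, 2 * expectedFaults μ σ =
      ∫⁻ A, 2 * (A.faults σ : ℝ≥0∞) ∂(μ : MeasureTheory.Measure (OnlineAlg G k)) := fun σ =>
    (MeasureTheory.lintegral_const_mul _ (OnlineAlg.measurable_faults σ)).symm
  have h1 : ∑ p ∈ S, 2 * expectedFaults μ (f p) < ∑ _p ∈ S, (2 * expectedFaults μ τ + d) :=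
    ENNReal.sum_lt_sum_of_nonempty hS hlt
  refine absurd h1 (not_lt.2 ?_)
  have h2 : ∑ p ∈ S, 2 * expectedFaults μ (f p) =
      ∫⁻ A, ∑ p ∈ S, 2 * (A.faults (f p) : ℝ≥0∞)
        ∂(μ : MeasureTheory.Measure (OnlineAlg G k)) := by
    rw [MeasureTheory.lintegral_finsetSum _
      fun p _ => (OnlineAlg.measurable_faults (f p)).const_mul 2]
    exact Finset.sum_congr rfl fun p _ => hint (f p)
  have h3 : (∑ _p ∈ S, (2 * expectedFaults μ τ + d) : ℝ≥0∞) =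
      ∫⁻ A, S.card * (2 * (A.faults τ : ℝ≥0∞) + d)
        ∂(μ : MeasureTheory.Measure (OnlineAlg G k)) := by
    have hm : Measurable fun A : OnlineAlg G k => 2 * (A.faults τ : ℝ≥0∞) + d :=
      ((OnlineAlg.measurable_faults τ).const_mul 2).add measurable_const
    rw [MeasureTheory.lintegral_const_mul _ hm,
      MeasureTheory.lintegral_add_right _ measurable_const, ← hint]
    simp [mul_add]
  rw [h2, h3]
  refine MeasureTheory.lintegral_mono fun A => ?_
  have : (S.card * (2 * (A.faults τ : ℝ≥0∞) + d)) ≤ ∑ p ∈ S, 2 * (A.faults (f p) : ℝ≥0∞) := by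
    exact_mod_cast h A
  exact this

end Expectation

/-! ### Lower bounds for the randomized ratio -/

section LowerBound

variable {m k : ℕ} {P : Type*} [Fintype P] [DecidableEq P]

/-- The adversary knows the distribution `μ`: in each of `T` rounds it picks a page whose closed
walk is at least as costly as the average. Each round adds d/2 expected faults and avoids a page. -/
theorem exists_walk_expectedFaults_ge (hP : Fintype.card P = k + 1) [Nontrivial P]
    (ℓ : Fin m → P) (μ : MeasureTheory.ProbabilityMeasure (OnlineAlg (pathEAG ℓ) k))
    (i : Fin m) {d : ℕ} (hd : 2 ^ d ≤ ((pathEAG ℓ).maximalPages i).card) (T : ℕ) :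
    ∃ σ, (pathEAG ℓ).IsWalk σ ∧ optCost k (σ.map ℓ) ≤ T + k ∧
      (T * d : ℝ≥0∞) ≤ 2 * expectedFaults μ σ := by
  obtain ⟨S, hS, hc⟩ := Finset.exists_subset_card_eq hd
  obtain ⟨W, h1, h2, h3⟩ := exists_round (k := k) hP ℓ i d S hS hc
  suffices H : ∃ L : List (List (Fin m)), L.length = T ∧ LoopAt ℓ i L.flatten ∧
      (∀ w ∈ L, ∃ q, q ∉ w.map ℓ) ∧ (T * d : ℝ≥0∞) ≤ 2 * expectedFaults μ L.flatten by
    obtain ⟨L, hT, hL, hq, hE⟩ := H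
    refine ⟨L.flatten, hL.isWalk, ?_, hE⟩
    rw [List.map_flatten]
    refine (optCost_flatten_le hP _ fun τ hτ => ?_).trans (by simp [hT])
    obtain ⟨w, hw, rfl⟩ := List.mem_map.1 hτ
    exact hq w hw
  induction T with
  | zero => exact ⟨[], rfl, loopAt_nil ℓ i, by simp, by simp⟩
  | succ T ih =>
    obtain ⟨L, hT, hL, hq, hE⟩ := ih
    have hne : S.Nonempty := Finset.card_pos.1 (by rw [hc]; positivity)
    obtain ⟨p, hp, hge⟩ := exists_expectedFaults_ge μ hne
      (fun p => L.flatten ++ W p) L.flatten d fun A => by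
        rw [hc]
        exact h3 A L.flatten
    refine ⟨L ++ [W p], by simp [hT], ?_, ?_, ?_⟩
    · simpa using hL.append (h1 p hp)
    · intro w hw
      rcases List.mem_append.1 hw with hw | hw
      · exact hq w hw
      · rw [List.mem_singleton.1 hw]
        exact ⟨p, h2 p hp⟩
    · rw [List.flatten_append, List.flatten_singleton]
      refine le_trans ?_ hge
      push_cast
      rw [add_mul, one_mul]
      gcongr

/-- A closed walk through all vertices requests all k + 1 pages, one of which is missing from any
memory; repeat it `T` times. -/
theorem exists_walk_optCost_ge (hk : 1 ≤ k) (hP : Fintype.card P = k + 1) {ℓ : Fin m → P}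
    (hℓ : Function.Surjective ℓ) (T : ℕ) :
    ∃ σ, (pathEAG ℓ).IsWalk σ ∧ T ≤ optCost k (σ.map ℓ) := by
  have : Nonempty P := Fintype.card_pos_iff.1 (by omega)
  obtain ⟨i, -⟩ := hℓ (Classical.arbitrary P)
  obtain ⟨w, hw, hall, -⟩ := exists_loopAt_cover ℓ i Finset.univ
  suffices H : ∃ σ, LoopAt ℓ i σ ∧
      ∀ C : ℕ → Finset P, IsService k (σ.map ℓ) C → T ≤ faultCount (σ.map ℓ) C by
    obtain ⟨σ, h1, h2⟩ := H
    obtain ⟨C, hC, h⟩ := exists_isService_eq_optCost hk (σ.map ℓ)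
    exact ⟨σ, h1.isWalk, h ▸ h2 C hC⟩
  induction T with
  | zero => exact ⟨[], loopAt_nil ℓ i, by simp⟩
  | succ T ih =>
    obtain ⟨σ, h1, h2⟩ := ih
    refine ⟨σ ++ w, h1.append hw, fun C hC => ?_⟩
    rw [List.map_append] at hC ⊢
    have hcard := hC.of_append.card_le
    obtain ⟨x, hx⟩ : ∃ x, x ∉ C (σ.map ℓ).length := by
      by_contra! hall
      have := Finset.card_le_card (fun x _ => hall x : Finset.univ ⊆ C (σ.map ℓ).length)
      rw [Finset.card_univ] at this
      omega
    obtain ⟨u, rfl⟩ := hℓ x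
    have := hC.faultCount_lt_of_mem hx (List.mem_map_of_mem (hall u (Finset.mem_univ u)))
    have := h2 C hC.of_append
    omega

theorem le_of_forall_nat_mul_le {a b c : ℝ} (h : ∀ T : ℕ, T * a ≤ T * b + c) : a ≤ b := by
  by_contra! hlt
  obtain ⟨T, hT⟩ := exists_nat_gt (c / (a - b))
  rw [div_lt_iff₀ (by linarith)] at hT
  linarith [h T]

/-- The optimum is unbounded and never exceeds the expected cost, so no additive constant rescues a
ratio below 1. This later absorbs the constant terms next to logarithms. -/
theorem one_le_rOblAsymp (hk : 1 ≤ k) (hP : Fintype.card P = k + 1) {ℓ : Fin m → P}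
    (hℓ : Function.Surjective ℓ) : 1 ≤ (pathEAG ℓ).rOblAsymp k := by
  refine le_iInf fun μ => le_sInf ?_
  rintro r ⟨C, hr⟩
  by_contra! hlt
  have hfin : r ≠ ⊤ := (hlt.trans ENNReal.one_lt_top).ne
  lift r to ℝ≥0 using hfin
  have hlt : r < 1 := by exact_mod_cast hlt
  have hlt : (r : ℝ) < 1 := by exact_mod_cast hlt
  obtain ⟨T, hT⟩ := exists_nat_gt ((C : ℝ) / (1 - r))
  obtain ⟨σ, hσ, hopt⟩ := exists_walk_optCost_ge hk hP hℓ T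
  have h1 := (optCost_le_expectedFaults μ σ).trans (hr σ hσ)
  have h2 : (optCost k (σ.map ℓ) : ℝ) ≤ r * (optCost k (σ.map ℓ) : ℝ) + C := by
    exact_mod_cast h1
  have h3 : (T : ℝ) ≤ optCost k (σ.map ℓ) := by exact_mod_cast hopt
  rw [div_lt_iff₀ (by linarith)] at hT
  nlinarith

theorem natCast_le_two_mul_rOblAsymp (hP : Fintype.card P = k + 1) [Nontrivial P]
    (ℓ : Fin m → P) (i : Fin m) {d : ℕ} (hd : 2 ^ d ≤ ((pathEAG ℓ).maximalPages i).card) :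
    (d : ℝ≥0∞) ≤ 2 * (pathEAG ℓ).rOblAsymp k := by
  have key : (d : ℝ≥0∞) / 2 ≤ (pathEAG ℓ).rOblAsymp k := by
    refine le_iInf fun μ => le_sInf ?_
    rintro r ⟨C, hr⟩
    by_cases hfin : r = ⊤
    · rw [hfin]
      exact le_top
    lift r to ℝ≥0 using hfin
    have h : (d : ℝ) ≤ 2 * r := by
      refine le_of_forall_nat_mul_le (c := 2 * (r * k + C)) fun T => ?_
      obtain ⟨σ, hσ, hopt, hE⟩ := exists_walk_expectedFaults_ge hP ℓ μ i hd T
      have h1 : (T * d : ℝ≥0∞) ≤ 2 * (r * ((T + k : ℕ) : ℝ≥0∞) + C) := by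
        refine hE.trans ?_
        gcongr
        refine (hr σ hσ).trans ?_
        gcongr
        exact hopt
      have h2 : (T * d : ℝ) ≤ 2 * (r * ((T + k : ℕ) : ℝ) + C) := by exact_mod_cast h1
      push_cast at h2
      linarith
    refine ENNReal.div_le_of_le_mul ?_
    rw [mul_comm]
    exact_mod_cast h
  calc (d : ℝ≥0∞) = 2 * (d / 2) := (ENNReal.mul_div_cancel (by simp) (by simp)).symm
    _ ≤ _ := by gcongr

theorem ofReal_log_card_le (hk : 1 ≤ k) (hP : Fintype.card P = k + 1) {ℓ : Fin m → P}
    (hℓ : Function.Surjective ℓ) (i : Fin m) :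
    ENNReal.ofReal (Real.log ((pathEAG ℓ).maximalPages i).card) ≤
      3 * (pathEAG ℓ).rOblAsymp k := by
  have : Nontrivial P := Fintype.one_lt_card_iff_nontrivial.1 (by omega)
  rcases Nat.eq_zero_or_pos ((pathEAG ℓ).maximalPages i).card with h0 | hpos
  · simp [h0]
  set n := ((pathEAG ℓ).maximalPages i).card with hn
  -- The factor 3 is 2 for the rounded-down binary logarithm plus 1 for the rounding error.
  have h1 := natCast_le_two_mul_rOblAsymp (k := k) hP ℓ i (d := Nat.log 2 n)
    (Nat.pow_log_le_self 2 hpos.ne')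
  have h2 := one_le_rOblAsymp hk hP hℓ
  have h3 : Real.log n ≤ ((Nat.log 2 n + 1 : ℕ) : ℝ) := by
    have : (n : ℝ) ≤ 2 ^ (Nat.log 2 n + 1) := by
      exact_mod_cast (Nat.lt_pow_succ_log_self one_lt_two n).le
    have := Real.log_le_log (by exact_mod_cast hpos) this
    rw [Real.log_pow] at this
    refine this.trans (mul_le_of_le_one_right (by positivity) ?_)
    linarith [Real.log_two_lt_d9]
  calc ENNReal.ofReal (Real.log n) ≤ ((Nat.log 2 n + 1 : ℕ) : ℝ≥0∞) := by
        rw [← ENNReal.ofReal_natCast]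
        exact ENNReal.ofReal_le_ofReal h3
    _ = (Nat.log 2 n : ℝ≥0∞) + 1 := by push_cast; rfl
    _ ≤ 2 * (pathEAG ℓ).rOblAsymp k + (pathEAG ℓ).rOblAsymp k := add_le_add h1 h2
    _ = 3 * (pathEAG ℓ).rOblAsymp k := by ring

theorem ofReal_maxLogMaximal_le (hk : 1 ≤ k) (hP : Fintype.card P = k + 1) {ℓ : Fin m → P}
    (hℓ : Function.Surjective ℓ) :
    ENNReal.ofReal (maxLogMaximal ℓ) ≤ 3 * (pathEAG ℓ).rOblAsymp k := by
  have : Nonempty P := Fintype.card_pos_iff.1 (by omega)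
  obtain ⟨i, -⟩ := hℓ (Classical.arbitrary P)
  have : Nonempty (Fin m) := ⟨i⟩
  obtain ⟨j, hj⟩ := exists_eq_ciSup_of_finite
    (f := fun i : Fin m => Real.log ((pathEAG ℓ).maximalPages i).card)
  rw [maxLogMaximal, ← hj]
  exact ofReal_log_card_le hk hP hℓ j

end LowerBound

/-! ### The choice of the page that MAXFAR evicts -/

/-- Halving removes a bit. Unlike a logarithm, the bit length also drops from 1 to 0, when the last
page goes. -/
theorem Nat.size_lt_size_of_two_mul_le {a b : ℕ} (h : 2 * a ≤ b) (hb : 0 < b) :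
    a.size < b.size := by
  rw [Nat.lt_size]
  rcases Nat.eq_zero_or_pos a with rfl | ha
  · simpa using Nat.succ_le_of_lt hb
  · obtain ⟨s, hs⟩ : ∃ s, a.size = s + 1 := Nat.exists_eq_succ_of_ne_zero (Nat.size_pos.2 ha).ne'
    have : 2 ^ s ≤ a := Nat.lt_size.1 (by omega)
    rw [hs, pow_succ]
    omega

section Victim

variable {m : ℕ} {P : Type*} [Fintype P] [DecidableEq P]

open scoped Classical in
/-- The page `q` may be evicted when `Y` is the set of marked pages and the phase began at `i`. -/
def VictimRule (ℓ : Fin m → P) (i : Fin m) (Y : Finset P) (q : P) : Prop :=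
  if (((pathEAG ℓ).maximalPages i \ Y).filter fun p => OnBothSides ℓ i p).Nonempty then
    IsMiddle ℓ i (((pathEAG ℓ).maximalPages i \ Y).filter fun p => OnBothSides ℓ i p) q
  else q ∈ (pathEAG ℓ).maximalPages i \ Y

theorem maxfarVictim_iff {ℓ : Fin m → P} {k : ℕ} {σ : List (Fin m)} {q : P} :
    MaxfarVictim ℓ k σ q ↔ ∃ i, ((pathEAG ℓ).currentPhase k σ).head? = some i ∧
      VictimRule ℓ i ((pathEAG ℓ).marked k σ) q :=
  Iff.rfl

theorem VictimRule.mem {ℓ : Fin m → P} {i : Fin m} {Y : Finset P} {q : P}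
    (h : VictimRule ℓ i Y q) : q ∈ (pathEAG ℓ).maximalPages i \ Y := by
  classical
  unfold VictimRule at h
  split_ifs at h
  · exact (Finset.mem_filter.1 h.1).1
  · exact h

theorem exists_victimRule [Nontrivial P] {ℓ : Fin m → P} {i : Fin m} {Y : Finset P}
    (h : ((pathEAG ℓ).maximalPages i \ Y).Nonempty) : ∃ q, VictimRule ℓ i Y q := by
  classical
  unfold VictimRule
  split_ifs with hN
  · have hsub : ∀ p ∈ ((pathEAG ℓ).maximalPages i \ Y).filter fun p => OnBothSides ℓ i p,
        p ∈ (pathEAG ℓ).maximalPages i := fun p hp =>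
      (Finset.mem_sdiff.1 (Finset.mem_filter.1 hp).1).1
    obtain ⟨q, hq, h1, h2⟩ := exists_middle (leftKey ℓ i) _
      ((leftKey_injOn ℓ i).mono fun p hp => hsub p hp) hN
    refine ⟨q, hq, ?_, ?_⟩
    · rwa [Finset.filter_congr fun p hp => (leftKey_lt_iff (hsub p hp) (hsub q hq)).symm]
    · rwa [Finset.filter_congr fun p hp => (leftKey_lt_iff (hsub q hq) (hsub p hp)).symm]
  · exact h

open scoped Classical in
/-- A bound for the number of faults of MAXFAR in the rest of a phase that began at `i`, if `Y`
is the set of marked pages. -/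
noncomputable def victimPotential (ℓ : Fin m → P) (i : Fin m) (Y : Finset P) : ℕ :=
  (((pathEAG ℓ).maximalPages i \ Y).filter fun p => OnBothSides ℓ i p).card.size +
    (((pathEAG ℓ).maximalPages i \ Y).filter fun p => ¬ OnBothSides ℓ i p).card

theorem victimPotential_le (ℓ : Fin m → P) (i : Fin m) (Y : Finset P) :
    victimPotential ℓ i Y ≤ ((pathEAG ℓ).maximalPages i).card.size + 2 := by
  classical
  refine add_le_add (Nat.size_le_size (Finset.card_le_card ?_))
    (card_maximalPages_oneSided_le (ℓ := ℓ) i _ fun p hp => ?_)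
  · exact (Finset.filter_subset _ _).trans Finset.sdiff_subset
  · rw [Finset.mem_filter, Finset.mem_sdiff] at hp
    exact ⟨hp.1.1, hp.2⟩

/-- A request for the page that was evicted decreases the potential. -/
theorem VictimRule.potential_lt [Nontrivial P] {ℓ : Fin m → P} {i : Fin m} {t : List (Fin m)}
    (ht : (pathEAG ℓ).IsWalk (i :: t)) {Y : Finset P} {q : P} (h : VictimRule ℓ i Y q)
    (hY : Y ⊆ ((i :: t).map ℓ).toFinset) (hq : q ∈ ((i :: t).map ℓ).toFinset) :
    victimPotential ℓ i ((i :: t).map ℓ).toFinset < victimPotential ℓ i Y := by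
  classical
  have hqM := (Finset.mem_sdiff.1 h.mem).1
  set Y' := ((i :: t).map ℓ).toFinset with hY'
  have hseg : ∀ {x u}, u ∈ i :: t → OnSegment i x u → ℓ x ∈ Y' := by
    intro x u hu hx
    rw [hY', List.mem_toFinset]
    exact List.mem_map_of_mem (IsWalk.mem_of_onSegment ht hu hx)
  have hsub : (pathEAG ℓ).maximalPages i \ Y' ⊆ (pathEAG ℓ).maximalPages i \ Y :=
    Finset.sdiff_subset_sdiff le_rfl hY
  unfold VictimRule at h
  unfold victimPotential
  split_ifs at h with hN
  · refine add_lt_add_of_lt_of_le (Nat.size_lt_size_of_two_mul_le ?_ hN.card_pos)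
      (Finset.card_le_card (Finset.filter_subset_filter _ hsub))
    obtain ⟨-, h1, h2⟩ := h
    obtain ⟨u, hu, huq⟩ := List.mem_map.1 (List.mem_toFinset.1 hq)
    have hui : u ≠ i := by
      rintro rfl
      exact label_notMem_maximalPages ℓ u (huq ▸ hqM)
    -- If `q` was reached on the left, the pages that stay unmarked come after `q` in the left
    -- order; if on the right, before it. Either way at most half remain.
    rcases lt_or_gt_of_ne hui with hlt | hgt
    · refine le_trans (Nat.mul_le_mul_left 2 (Finset.card_le_card ?_)) h2
      intro p hp
      simp only [Finset.mem_filter] at hp ⊢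
      refine ⟨⟨hsub hp.1, hp.2⟩, ?_⟩
      have hp' := Finset.mem_sdiff.1 hp.1
      have hne : p ≠ q := fun he => hp'.2 (he ▸ hq)
      refine (leftBefore_total hp'.1 hqM hne).resolve_left ?_
      rintro ⟨a, ha, hap, hclear⟩
      refine hp'.2 (hap ▸ hseg hu (Or.inr ⟨?_, ha.le⟩))
      by_contra hau
      exact hclear u (by omega) hlt huq
    · refine le_trans (Nat.mul_le_mul_left 2 (Finset.card_le_card ?_)) h1
      intro p hp
      simp only [Finset.mem_filter] at hp ⊢
      refine ⟨⟨hsub hp.1, hp.2⟩, ?_⟩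
      have hp' := Finset.mem_sdiff.1 hp.1
      have hne : p ≠ q := fun he => hp'.2 (he ▸ hq)
      refine (leftBefore_total hp'.1 hqM hne).resolve_right fun hqp => ?_
      obtain ⟨b, hb, hbp, hclear⟩ := hqp.exists_right hqM
      refine hp'.2 (hbp ▸ hseg hu (Or.inl ⟨hb, ?_⟩))
      by_contra hbu
      exact hclear u (Or.inl ⟨hgt.le, by omega⟩) huq
  -- Only one-sided pages were left, so `q` is one of them, and marking it lowers the second
  -- summand.
  · refine add_lt_add_of_le_of_lt
      (Nat.size_le_size (Finset.card_le_card (Finset.filter_subset_filter _ hsub)))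
      (Finset.card_lt_card ((Finset.ssubset_iff_of_subset
        (Finset.filter_subset_filter _ hsub)).2 ⟨q, ?_, ?_⟩))
    · refine Finset.mem_filter.2 ⟨h, fun hb => hN ⟨q, Finset.mem_filter.2 ⟨h, hb⟩⟩⟩
    · intro hq'
      exact (Finset.mem_sdiff.1 (Finset.mem_filter.1 hq').1).2 hq

variable {k : ℕ}

/-- MAXFAR always has a page to evict. -/
theorem exists_maxfarVictim (hk : 1 ≤ k) (hP : Fintype.card P = k + 1) {ℓ : Fin m → P}
    (hℓ : Function.Surjective ℓ) {σ : List (Fin m)} (hσ : (pathEAG ℓ).IsWalk σ) (hne : σ ≠ []) :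
    ∃ q, MaxfarVictim ℓ k σ q := by
  have : Nontrivial P := Fintype.one_lt_card_iff_nontrivial.1 (by omega)
  have hwalk := ExtendedAccessGraph.isWalk_currentPhase (k := k) hσ
  have hcp := ExtendedAccessGraph.currentPhase_ne_nil (G := pathEAG ℓ) (k := k) hne
  obtain ⟨i, t, hit⟩ := List.exists_cons_of_ne_nil hcp
  rw [hit] at hwalk
  have hmarked : ∀ p, p ∈ (pathEAG ℓ).marked k σ ↔ ∃ u ∈ i :: t, ℓ u = p := by
    intro p
    rw [ExtendedAccessGraph.marked, hit, List.mem_toFinset, List.mem_map]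
    rfl
  -- The marked pages are closed downward because the visited vertices form a segment around `i`,
  -- and they are not all k + 1 pages.
  obtain ⟨p, hp, hpm⟩ := exists_mem_maximalPages_notMem hℓ (i := i)
    (D := (pathEAG ℓ).marked k σ) (by
      intro p q hpq hq
      rw [hmarked] at hq ⊢
      obtain ⟨u, hu, huq⟩ := hq
      have := precedes_iff.1 hpq u huq
      unfold ClearOf at this
      push Not at this
      obtain ⟨x, hx, hxp⟩ := this
      exact ⟨x, IsWalk.mem_of_onSegment hwalk hu hx, hxp⟩) (by
      by_contra! hall
      have h1 := Finset.card_le_card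
        (fun x _ => hall x : Finset.univ ⊆ (pathEAG ℓ).marked k σ)
      have h2 := ExtendedAccessGraph.card_marked_le (G := pathEAG ℓ) hk σ
      rw [Finset.card_univ] at h1
      omega)
  obtain ⟨q, hq⟩ := exists_victimRule (ℓ := ℓ) (i := i) ⟨p, Finset.mem_sdiff.2 ⟨hp, hpm⟩⟩
  exact ⟨q, maxfarVictim_iff.2 ⟨i, by rw [hit]; rfl, hq⟩⟩

theorem MaxfarVictim.notMem_marked {ℓ : Fin m → P} {σ : List (Fin m)} {q : P}
    (h : MaxfarVictim ℓ k σ q) : q ∉ (pathEAG ℓ).marked k σ := by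
  obtain ⟨i, -, hi⟩ := maxfarVictim_iff.1 h
  exact (Finset.mem_sdiff.1 hi.mem).2

theorem eq_erase_of_notMem_of_card_eq (hP : Fintype.card P = k + 1) {S : Finset P} {p : P}
    (hp : p ∉ S) (hS : S.card = k) : S = Finset.univ.erase p := by
  refine Finset.eq_of_subset_of_card_le (fun x hx => ?_) ?_
  · refine Finset.mem_erase.2 ⟨?_, Finset.mem_univ x⟩
    rintro rfl
    exact hp hx
  · rw [Finset.card_erase_of_mem (Finset.mem_univ p), Finset.card_univ, hP, hS]
    omega

/-! ### MAXFAR exists -/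

open scoped Classical in
/-- One step of MAXFAR: the memory after the last request `v` of `σ`, if it was `S` before. -/
noncomputable def maxfarStep (ℓ : Fin m → P) (k : ℕ) (σ : List (Fin m)) (S : Finset P)
    (v : Fin m) : Finset P :=
  if ℓ v ∈ S then S
  else if S.card < k then insert (ℓ v) S
  else if h : ∃ q ∈ S, MaxfarVictim ℓ k σ q then insert (ℓ v) (S.erase h.choose)
  -- A default that keeps the service valid on arbitrary vertex lists; on walks a victim exists.
  else {ℓ v}

theorem label_mem_maxfarStep (ℓ : Fin m → P) (k : ℕ) (σ : List (Fin m)) (S : Finset P)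
    (v : Fin m) : ℓ v ∈ maxfarStep ℓ k σ S v := by
  classical
  unfold maxfarStep
  split_ifs with h1 <;> simp [*]

theorem maxfarStep_subset (ℓ : Fin m → P) (k : ℕ) (σ : List (Fin m)) (S : Finset P)
    (v : Fin m) : maxfarStep ℓ k σ S v ⊆ insert (ℓ v) S := by
  classical
  unfold maxfarStep
  split_ifs
  · exact Finset.subset_insert _ _
  · exact le_rfl
  · exact Finset.insert_subset_insert _ (Finset.erase_subset _ _)
  · simp

theorem card_maxfarStep_le (hk : 1 ≤ k) (ℓ : Fin m → P) (σ : List (Fin m)) {S : Finset P}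
    (hS : S.card ≤ k) (v : Fin m) : (maxfarStep ℓ k σ S v).card ≤ k := by
  classical
  unfold maxfarStep
  split_ifs with h1 h2 h3
  · exact hS
  · exact (Finset.card_insert_le _ _).trans h2
  · refine (Finset.card_insert_le _ _).trans ?_
    have := Finset.card_pos.2 ⟨_, h3.choose_spec.1⟩
    rw [Finset.card_erase_of_mem h3.choose_spec.1]
    omega
  · simpa

/-- The memory of MAXFAR after a reversed sequence of requests. -/
noncomputable def maxfarServeReverse (ℓ : Fin m → P) (k : ℕ) : List (Fin m) → Finset P
  | [] => ∅
  | v :: τ => maxfarStep ℓ k (τ.reverse ++ [v]) (maxfarServeReverse ℓ k τ) v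

theorem maxfarServeReverse_reverse_append (ℓ : Fin m → P) (k : ℕ) (σ : List (Fin m))
    (v : Fin m) : maxfarServeReverse ℓ k (σ ++ [v]).reverse =
      maxfarStep ℓ k (σ ++ [v]) (maxfarServeReverse ℓ k σ.reverse) v := by
  rw [List.reverse_append, List.reverse_singleton, List.singleton_append, maxfarServeReverse,
    List.reverse_reverse]

theorem isService_maxfar (hk : 1 ≤ k) (ℓ : Fin m → P) (σ : List (Fin m)) :
    IsService k (σ.map ℓ) fun i => maxfarServeReverse ℓ k (σ.take i).reverse := by
  induction σ using List.reverseRecOn with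
  | nil => exact isService_nil.2 rfl
  | append_singleton σ v ih =>
    have hc : ∀ i ≤ (σ.map ℓ).length, maxfarServeReverse ℓ k (σ.take i).reverse =
        maxfarServeReverse ℓ k ((σ ++ [v]).take i).reverse := fun i hi => by
      rw [List.length_map] at hi
      rw [List.take_append_of_le_length hi]
    rw [List.map_append, List.map_singleton]
    have h1 : (σ ++ [v]).take (σ.length + 1) = σ ++ [v] := List.take_of_length_le (by simp)
    have h2 : (σ ++ [v]).take σ.length = σ := by simp
    refine isService_append_singleton.2 ⟨ih.congr hc, ?_, ?_, ?_⟩ <;>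
      simp only [List.length_map, h1, h2, maxfarServeReverse_reverse_append]
    · exact label_mem_maxfarStep _ _ _ _ _
    · exact maxfarStep_subset _ _ _ _ _
    · exact card_maxfarStep_le hk _ _ (by simpa using ih.card_le) _

/-- The algorithm MAXFAR, with ties broken by choice. -/
noncomputable def maxfar (hk : 1 ≤ k) (ℓ : Fin m → P) : OnlineAlg (pathEAG ℓ) k where
  serve σ := maxfarServeReverse ℓ k σ.reverse
  valid σ := isService_maxfar hk ℓ σ

theorem isMaxfar_maxfar (hk : 1 ≤ k) (hP : Fintype.card P = k + 1) {ℓ : Fin m → P}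
    (hℓ : Function.Surjective ℓ) : IsMaxfar ℓ k (maxfar hk ℓ) := by
  classical
  intro σ v hσ
  have hstep : (maxfar hk ℓ).serve (σ ++ [v]) =
      maxfarStep ℓ k (σ ++ [v]) ((maxfar hk ℓ).serve σ) v :=
    maxfarServeReverse_reverse_append ℓ k σ v
  rw [hstep]
  set S := (maxfar hk ℓ).serve σ
  refine ⟨fun h => ?_, fun h hc => ?_, fun h hc => ?_⟩
  · rw [maxfarStep, if_pos h]
  · rw [maxfarStep, if_neg h, if_pos hc]
  · obtain ⟨q, hq⟩ := exists_maxfarVictim hk hP hℓ hσ (by simp)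
    -- A full memory lacks only the requested page, which is marked, whereas the victim is not.
    have hqS : q ∈ S := by
      rw [eq_erase_of_notMem_of_card_eq hP h hc]
      refine Finset.mem_erase.2 ⟨?_, Finset.mem_univ q⟩
      rintro rfl
      exact hq.notMem_marked (ExtendedAccessGraph.label_mem_marked_append_singleton σ v)
    have hex : ∃ q ∈ S, MaxfarVictim ℓ k (σ ++ [v]) q := ⟨q, hqS, hq⟩
    refine ⟨hex.choose, hex.choose_spec.1, hex.choose_spec.2, ?_⟩
    rw [maxfarStep, if_neg h, if_neg (by omega), dif_pos hex]

/-! ### The faults of MAXFAR -/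

/-- The state of MAXFAR after the first phase: `q` is the only page that is not in memory, it was
evicted when `Y` was the set of marked pages, and there were `j` faults in the current phase. -/
structure LateState (ℓ : Fin m → P) (k B : ℕ) (A : OnlineAlg (pathEAG ℓ) k)
    (σ pre t : List (Fin m)) (i : Fin m) (q : P) (Y : Finset P) (j : ℕ) : Prop where
  eq_append : σ = pre ++ i :: t
  pre_ne_nil : pre ≠ []
  currentPhase_eq : (pathEAG ℓ).currentPhase k σ = i :: t
  serve_eq : A.serve σ = Finset.univ.erase q
  notMem_marked : q ∉ (pathEAG ℓ).marked k σ
  subset_marked : Y ⊆ (pathEAG ℓ).marked k σ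
  rule : VictimRule ℓ i Y q
  faults_eq : A.faults σ = A.faults pre + j
  -- The 3 covers two one-sided pages and the fault that opens the phase.
  potential_le : j + victimPotential ℓ i Y ≤ ((pathEAG ℓ).maximalPages i).card.size + 3
  -- Distinct pages pay for the first phase and each phase change provides `B`; the `B` on the left
  -- is reserved for the current phase.
  faults_pre_le : A.faults pre + B ≤ (σ.map ℓ).toFinset.card + B * (pathEAG ℓ).phaseChanges k σ

/-- A fault with full memory merely moves the hole from the requested page to the victim. -/
theorem IsMaxfar.exists_of_serve_eq_erase (hP : Fintype.card P = k + 1) {ℓ : Fin m → P}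
    {A : OnlineAlg (pathEAG ℓ) k} (hA : IsMaxfar ℓ k A) {σ : List (Fin m)} {v : Fin m}
    (hσ : (pathEAG ℓ).IsWalk (σ ++ [v])) (hS : A.serve σ = Finset.univ.erase (ℓ v)) :
    ∃ q, MaxfarVictim ℓ k (σ ++ [v]) q ∧ A.serve (σ ++ [v]) = Finset.univ.erase q ∧
      A.faults (σ ++ [v]) = A.faults σ + 1 := by
  have hv : ℓ v ∉ A.serve σ := by simp [hS]
  obtain ⟨q, -, hq, hserve⟩ := (hA σ v hσ).2.2 hv (by
    rw [hS, Finset.card_erase_of_mem (Finset.mem_univ _), Finset.card_univ, hP]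
    rfl)
  refine ⟨q, hq, ?_, ?_⟩
  · have hne : ℓ v ≠ q := by
      rintro rfl
      exact hq.notMem_marked (ExtendedAccessGraph.label_mem_marked_append_singleton σ v)
    rw [hserve, hS]
    ext x
    by_cases hx : x = ℓ v <;> simp [hx, hne]
  · rw [A.faults_append_singleton]
    exact congrArg _ (if_neg hv)

/-- A new phase begins at `v`. -/
theorem IsMaxfar.lateState_of_phaseChange (hP : Fintype.card P = k + 1) {ℓ : Fin m → P} {B : ℕ}
    {A : OnlineAlg (pathEAG ℓ) k} (hA : IsMaxfar ℓ k A) {σ : List (Fin m)} {v : Fin m}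
    (hσ : (pathEAG ℓ).IsWalk (σ ++ [v])) (hS : A.serve σ = Finset.univ.erase (ℓ v))
    (hne : σ ≠ []) (hc : ¬ (insert (ℓ v) ((pathEAG ℓ).marked k σ)).card ≤ k)
    (hf : A.faults σ ≤ (σ.map ℓ).toFinset.card + B * (pathEAG ℓ).phaseChanges k σ) :
    ∃ q Y j, LateState ℓ k B A (σ ++ [v]) σ [] v q Y j := by
  obtain ⟨q, hq, hserve, hfaults⟩ := hA.exists_of_serve_eq_erase hP hσ hS
  have hcp : (pathEAG ℓ).currentPhase k (σ ++ [v]) = [v] := by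
    rw [ExtendedAccessGraph.currentPhase_append_singleton]
    exact if_neg hc
  obtain ⟨i, hi, hrule⟩ := maxfarVictim_iff.1 hq
  obtain rfl : v = i := by simpa [hcp] using hi
  refine ⟨q, _, 1, rfl, hne, hcp, hserve, hq.notMem_marked, le_rfl, hrule, hfaults, ?_, ?_⟩
  · have := victimPotential_le ℓ v ((pathEAG ℓ).marked k (σ ++ [v]))
    omega
  · have h1 : (σ.map ℓ).toFinset.card ≤ ((σ ++ [v]).map ℓ).toFinset.card := by
      refine Finset.card_le_card fun x hx => ?_
      simp only [List.map_append, List.mem_toFinset, List.mem_append] at hx ⊢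
      exact Or.inl hx
    have h2 : (pathEAG ℓ).phaseChanges k (σ ++ [v]) = (pathEAG ℓ).phaseChanges k σ + 1 := by
      rw [ExtendedAccessGraph.phaseChanges_append_singleton]
      exact congrArg _ (if_neg hc)
    rw [h2, mul_add]
    omega

/-- The state of MAXFAR is that of an unfilled memory or it is described by `LateState`. -/
theorem IsMaxfar.state (hk : 1 ≤ k) (hP : Fintype.card P = k + 1) {ℓ : Fin m → P} {B : ℕ}
    (hB : ∀ i, ((pathEAG ℓ).maximalPages i).card.size + 3 ≤ B)
    {A : OnlineAlg (pathEAG ℓ) k} (hA : IsMaxfar ℓ k A) {σ : List (Fin m)}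
    (hσ : (pathEAG ℓ).IsWalk σ) :
    ((pathEAG ℓ).currentPhase k σ = σ ∧ A.serve σ = (pathEAG ℓ).marked k σ ∧
      A.faults σ = ((pathEAG ℓ).marked k σ).card) ∨
    ∃ pre t i q Y j, LateState ℓ k B A σ pre t i q Y j := by
  have : Nontrivial P := Fintype.one_lt_card_iff_nontrivial.1 (by omega)
  induction σ using List.reverseRecOn with
  | nil => left; simp [ExtendedAccessGraph.marked]
  | append_singleton σ v ih =>
    have hcp := ExtendedAccessGraph.currentPhase_append_singleton (G := pathEAG ℓ) (k := k) σ v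
    have hmk := ExtendedAccessGraph.marked_append_singleton (G := pathEAG ℓ) (k := k) σ v
    have hpc := ExtendedAccessGraph.phaseChanges_append_singleton (G := pathEAG ℓ) (k := k) σ v
    have hfa := A.faults_append_singleton σ v
    have hlab : (pathEAG ℓ).label v = ℓ v := rfl
    rw [hlab] at hcp hmk hpc hfa
    have hcard := ExtendedAccessGraph.card_marked_le (G := pathEAG ℓ) hk σ
    obtain ⟨hhit, hfree, -⟩ := hA σ v hσ
    by_cases hc : (insert (ℓ v) ((pathEAG ℓ).marked k σ)).card ≤ k
    · rw [if_pos hc] at hcp hmk hpc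
      rcases ih hσ.left_of_append with ⟨h1, h2, h3⟩ | ⟨pre, t, i, q, Y, j, h⟩
      · left
        rw [hcp, hmk, hfa, h1, h2, h3]
        refine ⟨rfl, ?_, ?_⟩
        · by_cases hv : ℓ v ∈ A.serve σ
          · rw [hhit hv, h2, Finset.insert_eq_self.2 (h2 ▸ hv)]
          · rw [hfree hv, h2]
            rw [h2] at hv ⊢
            rw [Finset.card_insert_of_notMem hv] at hc
            omega
        · by_cases hv : ℓ v ∈ (pathEAG ℓ).marked k σ
          · rw [if_pos hv, Finset.insert_eq_self.2 hv, add_zero]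
          · rw [if_neg hv, Finset.card_insert_of_notMem hv]
      · right
        have hcp' : (pathEAG ℓ).currentPhase k (σ ++ [v]) = i :: (t ++ [v]) := by
          rw [hcp, h.currentPhase_eq, List.cons_append]
        have hpre : A.faults pre + B ≤ ((σ ++ [v]).map ℓ).toFinset.card +
            B * (pathEAG ℓ).phaseChanges k (σ ++ [v]) := by
          rw [hpc, add_zero]
          refine h.faults_pre_le.trans (Nat.add_le_add_right (Finset.card_le_card fun x hx => ?_) _)
          simp only [List.map_append, List.mem_toFinset, List.mem_append] at hx ⊢
          exact Or.inl hx
        have heq : σ ++ [v] = pre ++ i :: (t ++ [v]) := by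
          rw [h.eq_append, List.append_assoc, List.cons_append]
        -- Only a request for the missing page is a fault; it raises `j` by one and lowers the
        -- potential by at least one.
        by_cases hv : ℓ v = q
        · obtain ⟨q', hq', hserve, hfaults⟩ :=
            hA.exists_of_serve_eq_erase hP hσ (hv ▸ h.serve_eq)
          obtain ⟨i', hi', hrule⟩ := maxfarVictim_iff.1 hq'
          obtain rfl : i = i' := by simpa [hcp'] using hi'
          refine ⟨pre, t ++ [v], i, q', _, j + 1, heq, h.pre_ne_nil, hcp', hserve,
            hq'.notMem_marked, le_rfl, hrule, by rw [hfaults, h.faults_eq, add_assoc], ?_, hpre⟩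
          have hw := ExtendedAccessGraph.isWalk_currentPhase (k := k) hσ
          have hm : (pathEAG ℓ).marked k (σ ++ [v]) =
              ((i :: (t ++ [v])).map ℓ).toFinset := by
            rw [ExtendedAccessGraph.marked, hcp']
            rfl
          rw [hcp'] at hw
          have hlt := h.rule.potential_lt hw
            (by rw [← hm, hmk]; exact h.subset_marked.trans (Finset.subset_insert _ _))
            (by rw [← hm, hmk, ← hv]; exact Finset.mem_insert_self _ _)
          rw [← hm] at hlt
          have := h.potential_le
          omega
        · have hv' : ℓ v ∈ A.serve σ := by
            rw [h.serve_eq]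
            simpa using hv
          refine ⟨pre, t ++ [v], i, q, Y, j, heq, h.pre_ne_nil, hcp',
            (hhit hv').trans h.serve_eq, ?_, ?_, h.rule, ?_, h.potential_le, hpre⟩
          · rw [hmk, Finset.mem_insert, not_or]
            exact ⟨Ne.symm hv, h.notMem_marked⟩
          · rw [hmk]
            exact h.subset_marked.trans (Finset.subset_insert _ _)
          · rw [hfa, if_pos hv', add_zero, h.faults_eq]
    · right
      have hvm : ℓ v ∉ (pathEAG ℓ).marked k σ := fun hv => by
        rw [Finset.insert_eq_self.2 hv] at hc
        exact hc hcard
      have hfull : ((pathEAG ℓ).marked k σ).card = k := by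
        rw [Finset.card_insert_of_notMem hvm] at hc
        omega
      have hmarked := eq_erase_of_notMem_of_card_eq hP hvm hfull
      have hne : σ ≠ [] := by
        rintro rfl
        simp [ExtendedAccessGraph.marked] at hfull
        omega
      refine ⟨σ, [], v, ?_⟩
      rcases ih hσ.left_of_append with ⟨h1, h2, h3⟩ | ⟨pre, t, i, q, Y, j, h⟩
      · refine hA.lateState_of_phaseChange hP hσ (h2.trans hmarked) hne hc ?_
        rw [h3, ExtendedAccessGraph.marked, h1]
        exact Nat.le_add_right _ _
      -- At a phase change all pages but the requested one are marked, so the unmarked missing page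
      -- is the requested one.
      · have hqv : q = ℓ v := by
          by_contra hqv
          refine h.notMem_marked ?_
          rw [hmarked]
          simpa using hqv
        refine hA.lateState_of_phaseChange hP hσ (hqv ▸ h.serve_eq) hne hc ?_
        have := h.faults_pre_le
        have := h.faults_eq
        have := h.potential_le
        have := hB i
        omega

theorem IsMaxfar.faults_le_phase (hk : 1 ≤ k) (hP : Fintype.card P = k + 1) {ℓ : Fin m → P}
    {B : ℕ} (hB : ∀ i, ((pathEAG ℓ).maximalPages i).card.size + 3 ≤ B)
    {A : OnlineAlg (pathEAG ℓ) k} (hA : IsMaxfar ℓ k A) {pre ph : List (Fin m)}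
    (hσ : (pathEAG ℓ).IsWalk (pre ++ ph)) (hpre : pre ≠ [])
    (hph : (pathEAG ℓ).currentPhase k (pre ++ ph) = ph) :
    A.faults (pre ++ ph) ≤ A.faults pre + B := by
  rcases hA.state hk hP hB hσ with ⟨h1, -⟩ | ⟨pre', t, i, q, Y, j, h⟩
  · rw [hph, eq_comm, List.append_left_eq_self] at h1
    exact absurd h1 hpre
  · have h1 : ph = i :: t := hph.symm.trans h.currentPhase_eq
    have h2 : pre = pre' := by
      have := h.eq_append
      rw [← h1] at this
      exact List.append_cancel_right this
    have := h.faults_eq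
    have := h.potential_le
    have := hB i
    rw [h2] at *
    omega

/-- Distinct pages and phase changes are each at most the optimum, so no additive constant is left.
-/
theorem IsMaxfar.faults_le_optCost (hk : 1 ≤ k) (hP : Fintype.card P = k + 1) {ℓ : Fin m → P}
    {B : ℕ} (hB : ∀ i, ((pathEAG ℓ).maximalPages i).card.size + 3 ≤ B)
    {A : OnlineAlg (pathEAG ℓ) k} (hA : IsMaxfar ℓ k A) {σ : List (Fin m)}
    (hσ : (pathEAG ℓ).IsWalk σ) : A.faults σ ≤ (1 + B) * optCost k (σ.map ℓ) := by
  have h1 := card_toFinset_le_optCost hk (σ.map ℓ)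
  have h2 : (pathEAG ℓ).phaseChanges k σ ≤ optCost k (σ.map ℓ) :=
    ExtendedAccessGraph.phaseChanges_le_optCost hk σ
  have h3 : A.faults σ ≤ (σ.map ℓ).toFinset.card + B * (pathEAG ℓ).phaseChanges k σ := by
    rcases hA.state hk hP hB hσ with ⟨e1, -, e3⟩ | ⟨pre, t, i, q, Y, j, h⟩
    · rw [e3, ExtendedAccessGraph.marked, e1]
      exact Nat.le_add_right _ _
    · have := h.faults_pre_le
      have := h.faults_eq
      have := h.potential_le
      have := hB i
      omega
  calc A.faults σ ≤ _ := h3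
    _ ≤ optCost k (σ.map ℓ) + B * optCost k (σ.map ℓ) :=
        add_le_add h1 (Nat.mul_le_mul_left B h2)
    _ = _ := by ring

theorem log_card_le_maxLogMaximal (ℓ : Fin m → P) (i : Fin m) :
    Real.log ((pathEAG ℓ).maximalPages i).card ≤ maxLogMaximal ℓ :=
  le_ciSup (f := fun i : Fin m => Real.log ((pathEAG ℓ).maximalPages i).card)
    (Set.finite_range _).bddAbove i

theorem maxLogMaximal_nonneg (ℓ : Fin m → P) : 0 ≤ maxLogMaximal ℓ :=
  Real.iSup_nonneg fun _ => Real.log_natCast_nonneg _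

theorem Nat.cast_size_le_log (n : ℕ) : (n.size : ℝ) ≤ 1 + 2 * Real.log n := by
  rcases Nat.eq_zero_or_pos n with rfl | hn
  · simp
  obtain ⟨s, hs⟩ : ∃ s, n.size = s + 1 := Nat.exists_eq_succ_of_ne_zero (Nat.size_pos.2 hn).ne'
  have h1 : 2 ^ s ≤ n := Nat.lt_size.1 (by omega)
  have h2 : ((2 : ℝ) ^ s) ≤ n := by exact_mod_cast h1
  have h3 := Real.log_le_log (by positivity) h2
  rw [Real.log_pow] at h3
  have h4 : (s : ℝ) * (1 / 2) ≤ s * Real.log 2 := by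
    gcongr
    linarith [Real.log_two_gt_d9]
  rw [hs]
  push_cast
  linarith

theorem exists_phase_bound (ℓ : Fin m → P) :
    ∃ B : ℕ, (∀ i, ((pathEAG ℓ).maximalPages i).card.size + 3 ≤ B) ∧
      (B : ℝ) ≤ 4 + 2 * maxLogMaximal ℓ := by
  refine ⟨⌊4 + 2 * maxLogMaximal ℓ⌋₊, fun i => Nat.le_floor ?_, Nat.floor_le ?_⟩
  · have h1 := Nat.cast_size_le_log ((pathEAG ℓ).maximalPages i).card
    have h2 := log_card_le_maxLogMaximal ℓ i
    push_cast
    linarith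
  · have := maxLogMaximal_nonneg ℓ
    linarith

theorem IsMaxfar.strictRatio_le (hk : 1 ≤ k) (hP : Fintype.card P = k + 1) {ℓ : Fin m → P}
    (hℓ : Function.Surjective ℓ) {A : OnlineAlg (pathEAG ℓ) k} (hA : IsMaxfar ℓ k A) :
    A.strictRatio ≤ 11 * (pathEAG ℓ).rOblAsymp k := by
  obtain ⟨B, hB, hB'⟩ := exists_phase_bound ℓ
  have h1 : A.strictRatio ≤ ((1 + B : ℕ) : ℝ≥0∞) := sInf_le fun σ hσ => by
    have := hA.faults_le_optCost hk hP hB hσ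
    exact_mod_cast this
  have h2 : ((1 + B : ℕ) : ℝ≥0∞) ≤ 5 + 2 * ENNReal.ofReal (maxLogMaximal ℓ) := by
    have h0 := maxLogMaximal_nonneg ℓ
    have h3 : ((1 + B : ℕ) : ℝ) ≤ 5 + 2 * maxLogMaximal ℓ := by
      push_cast
      linarith
    rw [← ENNReal.ofReal_natCast]
    refine (ENNReal.ofReal_le_ofReal h3).trans ?_
    rw [ENNReal.ofReal_add (by norm_num) (by positivity), ENNReal.ofReal_mul (by norm_num)]
    simp
  -- 11 = 5 · 1 + 2 · 3: the constant is charged to the trivial bound and the logarithm to the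
  -- adversary.
  calc A.strictRatio ≤ _ := h1
    _ ≤ _ := h2
    _ ≤ 5 * (pathEAG ℓ).rOblAsymp k + 2 * (3 * (pathEAG ℓ).rOblAsymp k) := by
        refine add_le_add ?_ (mul_le_mul_right (ofReal_maxLogMaximal_le hk hP hℓ) 2)
        exact le_mul_of_one_le_right' (one_le_rOblAsymp hk hP hℓ)
    _ = _ := by ring

end Victim

theorem ExtendedAccessGraph.rOblAsymp_le_rOblAsympPages {V P : Type*} [DecidableEq P]
    (G : ExtendedAccessGraph V P) (k : ℕ) : G.rOblAsymp k ≤ G.rOblAsympPages k :=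
  le_iInf fun μ => iInf_le _ μ.1

theorem mainTheorem4 :
    ∃ c : ℝ≥0, ∀ (k m : ℕ) (P : Type*) [Fintype P] [DecidableEq P] (ℓ : Fin m → P),
      1 ≤ k → Fintype.card P = k + 1 → Function.Surjective ℓ →
      (∃ A : OnlineAlg (pathEAG ℓ) k, IsMaxfar ℓ k A) ∧
      (∀ A : OnlineAlg (pathEAG ℓ) k, IsMaxfar ℓ k A →
        A.strictRatio ≤ c * (pathEAG ℓ).rOblAsymp k ∧
        A.strictRatio ≤ c * (pathEAG ℓ).rOblAsympPages k) ∧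
      ENNReal.ofReal (maxLogMaximal ℓ) ≤ c * (pathEAG ℓ).rOblAsymp k ∧
      (∀ A : OnlineAlg (pathEAG ℓ) k, IsMaxfar ℓ k A →
        ∀ pre ph : List (Fin m), (pathEAG ℓ).IsWalk (pre ++ ph) → pre ≠ [] →
          (pathEAG ℓ).currentPhase k (pre ++ ph) = ph →
          (A.faults (pre ++ ph) : ℝ) ≤ A.faults pre + c * (1 + maxLogMaximal ℓ)) := by
  refine ⟨11, fun k m P _ _ ℓ hk hP hℓ => ⟨⟨maxfar hk ℓ, isMaxfar_maxfar hk hP hℓ⟩,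
    fun A hA => ⟨?_, ?_⟩, ?_, fun A hA pre ph hσ hpre hph => ?_⟩⟩
  · exact_mod_cast hA.strictRatio_le hk hP hℓ
  · refine (hA.strictRatio_le hk hP hℓ).trans ?_
    push_cast
    gcongr
    exact (pathEAG ℓ).rOblAsymp_le_rOblAsympPages k
  · refine (ofReal_maxLogMaximal_le hk hP hℓ).trans ?_
    push_cast
    gcongr
    norm_num
  · obtain ⟨B, hB, hB'⟩ := exists_phase_bound ℓ
    have h1 : (A.faults (pre ++ ph) : ℝ) ≤ A.faults pre + B := by
      exact_mod_cast hA.faults_le_phase hk hP hB hσ hpre hph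
    have h2 := maxLogMaximal_nonneg ℓ
    push_cast
    linarith
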